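/- Let $\Omega\subseteq\mathbb{R}^2$ be an open neighbourhood of $0$ and let $\phi:\Omega\to\mathbb{R}$ be smooth with $\phi(0)=0$, $\nabla\phi(0)=0$ and of finite type at $0$ (some $\partial^\alpha\phi(0)\neq0$). Let $S$ be the graph of $\phi$ with surface measure $\mathrm d\sigma$, and let $0\le\rho\in C_c^\infty(S)$ satisfy $\rho\neq0$ at the point of $S$ over the origin. Let $p_1,p_3\in[1,\infty]$ with dual exponents $p_1',p_3'$, and suppose that for some constant $C$ $$\Big(\int_S|\widehat f|^2\rho\,\mathrm d\sigma\Big)^{1/2}\le C\,\|f\|_{L^{p_3}_{x_3}(L^{p_1}_{(x_1,x_2)})}\qquad\text{for all } f\in\mathcal S(\mathbb{R}^3).$$ *Definitions.* For a function $g$ smooth near $0\in\mathbb{R}^2$ and of finite type at $0$, the Newton polyhedron $\mathcal N(g)$ is the convex hull of $\bigcup_{\alpha:\,\partial^\alpha g(0)\ne0}\{t\in\mathbb{R}^2: t_1\ge\alpha_1,\ t_2\ge\alpha_2\}$, and the Newton distance $d(g)$ is the smallest $d$ with $(d,d)\in\mathcal N(g)$. The height $h(\phi)$ (resp. linear height $h_{\rm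 lin}(\phi)$) is the supremum of $d(\phi\circ\varphi)$ over all smooth local coordinate changes $\varphi$ at $0$ with $\varphi(0)=0$ (resp. all invertible linear maps $\varphi$). One calls $\phi$ adapted if $d(\phi)=h(\phi)$ and linearly adapted if $d(\phi)=h_{\rm lin}(\phi)$. For $\tilde\kappa\in[0,\infty)^2$ put $L_{\tilde\kappa}=\{t\in\mathbb{R}^2:\tilde\kappa_1t_1+\tilde\kappa_2t_2=1\}$. (i) If $\phi$ is adapted, then $$\frac1{d(\phi)\,p_1'}+\frac1{p_3'}\le\frac1{2d(\phi)}.$$ (ii) Suppose that $\phi$ is linearly adapted but not adapted. Let $\kappa\in[0,\infty)^2$ be the weight such that $L_\kappa$ contains the edge of $\mathcal N(\phi)$ through $(d(\phi),d(\phi))$ (if this point is a vertex: the edge having it as its left endpoint); assume, as one may after interchanging the coordinates, that $\kappa_1\le\kappa_2$, and put $m=\kappa_2/\kappa_1$. Let $\psi$ be smooth near $0\in\mathbb{R}$ with $\psi(0)=0$ and such that the coordinates $y_1=x_1$, $y_2=x_2-\psi(x_1)$ are adapted, that is, $\phi^a(y)=\phi(y_1,y_2+\psi(y_1))$ satisfies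 $d(\phi^a)=h(\phi)$. Let $P$ be the point of $L_\kappa\cap\mathcal N(\phi^a)$ with smallest second coordinate $t_2^P$, let $L^+=\{t\in L_\kappa:t_2\ge t_2^P\}$, and let $\mathcal N^{\rm res}(\phi^a)$ be the convex hull of $\mathcal N(\phi^a)\cup L^+$. For $u\in[0,\kappa_1]$ let $K(u)\in[0,\infty]$ be the least $v\ge0$ for which $L_{(u,v)}$ is a supporting line of $\mathcal N^{\rm res}(\phi^a)$, with $K(u)=+\infty$ if there is no such $v$, and let $\mathcal L(K)[w]=\sup_{u\in[0,\kappa_1]}(wu-K(u))$. Then $$\frac1{p_3'}\le-\frac12\,\mathcal L(K)\Big[\frac{2+2m}{p_1'}-1\Big].$$ -/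

import Mathlib

open MeasureTheory Set Filter Topology FourierTransform
open scoped ENNReal NNReal ContDiff SchwartzMap

noncomputable section

namespace MixedRestriction

/-! ### The restriction estimate -/

/-- The point `(x₁, x₂, t)` of Euclidean three-space. -/
def pt (x : ℝ × ℝ) (t : ℝ) : EuclideanSpace ℝ (Fin 3) := !₂[x.1, x.2, t]

/-- The mixed norm `L^{p₃}_{x₃}(L^{p₁}_{(x₁,x₂)})`, with essential suprema for infinite exponents. -/
def mixedNorm (p₁ p₃ : ℝ≥0∞) (f : EuclideanSpace ℝ (Fin 3) → ℂ) : ℝ≥0∞ :=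
  eLpNorm (fun t : ℝ => eLpNorm (fun x : ℝ × ℝ => f (pt x t)) p₁ volume) p₃ volume

/-- The density `√(1 + |∇φ|²)` of the surface measure of the graph of `φ`. -/
def surfaceDensity (φ : ℝ × ℝ → ℝ) (x : ℝ × ℝ) : ℝ :=
  √(1 + (fderiv ℝ φ x (1, 0)) ^ 2 + (fderiv ℝ φ x (0, 1)) ^ 2)

/-- `∫_S |F|² ρ dσ` for the graph `S` of `φ` over `Ω`; the function `ρ` on `S` is written in the
graph coordinates `(x₁, x₂)`. -/
def surfaceIntegralSq (Ω : Set (ℝ × ℝ)) (φ ρ : ℝ × ℝ → ℝ)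
    (F : EuclideanSpace ℝ (Fin 3) → ℂ) : ℝ≥0∞ :=
  ∫⁻ x in Ω, ‖F (pt x (φ x))‖ₑ ^ 2 * ENNReal.ofReal (ρ x * surfaceDensity φ x)

/-- The mixed norm `L^p - L²` Fourier restriction estimate for the graph of `φ` over `Ω`. -/
def RestrictionEstimate (Ω : Set (ℝ × ℝ)) (φ ρ : ℝ × ℝ → ℝ) (p₁ p₃ : ℝ≥0∞) : Prop :=
  ∃ C : ℝ≥0, ∀ f : 𝓢(EuclideanSpace ℝ (Fin 3), ℂ),
    (surfaceIntegralSq Ω φ ρ (𝓕 (f : EuclideanSpace ℝ (Fin 3) → ℂ))) ^ (1 / 2 : ℝ)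
      ≤ C * mixedNorm p₁ p₃ f

/-! ### Newton polyhedra -/

/-- `∂₁^{α₁} ∂₂^{α₂} φ(0)`. -/
def partialAtZero (φ : ℝ × ℝ → ℝ) (α : ℕ × ℕ) : ℝ :=
  iteratedFDeriv ℝ (α.1 + α.2) φ 0
    (fun i => if (i : ℕ) < α.1 then ((1, 0) : ℝ × ℝ) else (0, 1))

def taylorSupport (φ : ℝ × ℝ → ℝ) : Set (ℕ × ℕ) := {α | partialAtZero φ α ≠ 0}

def newtonPolyhedron (φ : ℝ × ℝ → ℝ) : Set (ℝ × ℝ) :=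
  convexHull ℝ (⋃ α ∈ taylorSupport φ, {t : ℝ × ℝ | (α.1 : ℝ) ≤ t.1 ∧ (α.2 : ℝ) ≤ t.2})

/-- The Newton distance: the bisectrix `t₁ = t₂` enters the Newton polyhedron at `(d, d)`. -/
def newtonDistance (φ : ℝ × ℝ → ℝ) : ℝ := sInf {t : ℝ | (t, t) ∈ newtonPolyhedron φ}

/-- Smooth local coordinate changes at the origin, fixing the origin. -/
def IsLocalCoordinateChange (Φ : ℝ × ℝ → ℝ × ℝ) : Prop :=
  (∀ᶠ x in 𝓝 (0 : ℝ × ℝ), ContDiffAt ℝ ∞ Φ x) ∧ Φ 0 = 0 ∧ (fderiv ℝ Φ 0).IsInvertible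

/-- The height `h(φ)`. -/
def height (φ : ℝ × ℝ → ℝ) : EReal :=
  ⨆ (Φ : ℝ × ℝ → ℝ × ℝ) (_ : IsLocalCoordinateChange Φ), (newtonDistance (φ ∘ Φ) : EReal)

/-- The linear height `h_lin(φ)`. -/
def linearHeight (φ : ℝ × ℝ → ℝ) : EReal :=
  ⨆ L : (ℝ × ℝ) ≃L[ℝ] (ℝ × ℝ), (newtonDistance (φ ∘ L) : EReal)

def IsAdapted (φ : ℝ × ℝ → ℝ) : Prop := (newtonDistance φ : EReal) = height φ

def IsLinearlyAdapted (φ : ℝ × ℝ → ℝ) : Prop := (newtonDistance φ : EReal) = linearHeight φ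

/-- The line `L_κ`. -/
def weightLine (κ : ℝ × ℝ) : Set (ℝ × ℝ) := {t | κ.1 * t.1 + κ.2 * t.2 = 1}

/-- `κ ∈ [0,∞)²` and `L_κ` is a supporting line of `N`. (The sets `N` considered here are stable
under adding vectors of the positive quadrant, so they can only lie on the upper side.) -/
def IsSupportingWeight (N : Set (ℝ × ℝ)) (κ : ℝ × ℝ) : Prop :=
  0 ≤ κ.1 ∧ 0 ≤ κ.2 ∧ (∀ t ∈ N, 1 ≤ κ.1 * t.1 + κ.2 * t.2) ∧ (weightLine κ ∩ N).Nonempty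

/-- `κ` is the weight belonging to the principal face of the Newton polyhedron: `L_κ` contains an
edge through `(d, d)`; if `(d, d)` is a vertex, this edge is the one with left endpoint `(d, d)`. -/
def IsPrincipalWeight (φ : ℝ × ℝ → ℝ) (κ : ℝ × ℝ) : Prop :=
  IsSupportingWeight (newtonPolyhedron φ) κ ∧
  (weightLine κ ∩ newtonPolyhedron φ).Nontrivial ∧
  (newtonDistance φ, newtonDistance φ) ∈ weightLine κ ∩ newtonPolyhedron φ ∧
  ((newtonDistance φ, newtonDistance φ) ∈ (newtonPolyhedron φ).extremePoints ℝ →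
    ∀ t ∈ weightLine κ ∩ newtonPolyhedron φ,
      t ≠ (newtonDistance φ, newtonDistance φ) → newtonDistance φ < t.1)

/-- `φ` in the coordinates `y₁ = x₁`, `y₂ = x₂ - ψ(x₁)`. -/
def shear (φ : ℝ × ℝ → ℝ) (ψ : ℝ → ℝ) : ℝ × ℝ → ℝ := fun y => φ (y.1, y.2 + ψ y.1)

/-- The coordinates `y₁ = x₁`, `y₂ = x₂ - ψ(x₁)`, with `ψ` smooth near `0` and `ψ(0) = 0`, are
adapted to `φ`. -/
def IsAdaptedShear (φ : ℝ × ℝ → ℝ) (ψ : ℝ → ℝ) : Prop :=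
  (∀ᶠ s in 𝓝 (0 : ℝ), ContDiffAt ℝ ∞ ψ s) ∧ ψ 0 = 0 ∧
    (newtonDistance (shear φ ψ) : EReal) = height φ

/-- The ray `L⁺`: the part of `L_κ` at or above the lowest point of `L_κ ∩ 𝓝(φᵃ)`. -/
def augmentingRay (φa : ℝ × ℝ → ℝ) (κ : ℝ × ℝ) : Set (ℝ × ℝ) :=
  {t | t ∈ weightLine κ ∧ ∃ s ∈ weightLine κ ∩ newtonPolyhedron φa, s.2 ≤ t.2}

/-- The augmented Newton polyhedron. -/
def augmentedPolyhedron (φa : ℝ × ℝ → ℝ) (κ : ℝ × ℝ) : Set (ℝ × ℝ) :=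
  convexHull ℝ (newtonPolyhedron φa ∪ augmentingRay φa κ)

/-- The function `K`: `K(u)` is the `v` for which `(u, v)` is the weight of a supporting line of
`N`. It is `+∞` if there is no such `v`; if there are several (which happens only if the line
touches `N` at a point with `t₂ = 0`), the least one is taken. -/
def supportFunction (N : Set (ℝ × ℝ)) (u : ℝ) : EReal :=
  ⨅ (v : ℝ) (_ : IsSupportingWeight N (u, v)), (v : EReal)

/-- The Legendre transform on `[0, a]`. -/
def legendre (a : ℝ) (K : ℝ → EReal) (w : ℝ) : EReal :=
  ⨆ u ∈ Icc (0 : ℝ) a, (((w * u : ℝ) : EReal) - K u)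

end MixedRestriction

end

open MixedRestriction

namespace MixedRestriction

/-! The proof is a Knapp-type test. If `f` is a bump adapted to the box `|xᵢ| ≲ 1 / sᵢ`, then `|𝓕
f|` is at least a constant times `∏ 1 / sᵢ` on a small multiple of the box `|ξᵢ| ≤ sᵢ`, so the
estimate bounds the measure of any piece of surface inside that box. Take `s` comparable to `(ε^u,
ε^μ, ε)`, where `μ ≤ v`, `ψ = O(|s|^(μ/u))` and all Taylor exponents of `shear φ ψ` satisfy `u α₁ +
v α₂ ≥ 1`. The box then contains the surface over `|x₁| < ε^u`, `|x₂ - ψ(x₁)| < ε^v`, and comparing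
powers of `ε` gives `1/p₃' + (u + μ)/p₁' ≤ (u + v)/2` (`knapp_condition`).

For (i) take `ψ = 0`, `μ = v` and a supporting line through `(d, d)`, so that `u + v = 1/d`. For
(ii) take `μ = m u`: the condition becomes `1/p₃' ≤ -(w u - v)/2` with `w = (2 + 2m)/p₁' - 1`, for
every supporting weight `(u, v)` of the augmented polyhedron, and optimising over `u` produces the
Legendre transform. This choice of `μ` is admissible because `v ≥ m u`, forced by the ray `L⁺`
(`slope_le_of_supports_augmentedPolyhedron`), and because `ψ = O(|s|^m)` (`adaptedShear_order`). The
latter is the core: a leading term `c s^n` with `n < m` would translate the edge polynomial of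
weight `(1, n)` by `c`, and counting root multiplicities shows that the Newton distance would not
grow (`newtonDistance_shear_le`), whereas an adapted shear of a non-adapted `φ` must increase it.

Shears are handled without differentiating compositions: for positive weights, the Taylor support
lies in `u t₁ + v t₂ ≥ r` exactly when `g = O(ε^r)` on boxes of size `ε^u × ε^v`
(`SmoothNear.growth`, `SmoothNear.le_weight_of_growth`). -/

/-! ### Symmetry of iterated derivatives of smooth functions -/

section Symmetry

variable {E : Type*} [NormedAddCommGroup E] [NormedSpace ℝ E]

/-- Smoothness in a neighbourhood of a point. -/
def SmoothNear (g : E → ℝ) (x : E) : Prop := ∀ᶠ y in 𝓝 x, ContDiffAt ℝ ∞ g y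

theorem SmoothNear.contDiffAt {g : E → ℝ} {x : E} (hg : SmoothNear g x) : ContDiffAt ℝ ∞ g x :=
  hg.self_of_nhds

/-- The iterated directional derivative along the vectors of a list. -/
noncomputable def listDeriv (g : E → ℝ) (l : List E) : E → ℝ :=
  l.foldr (fun v h y => fderiv ℝ h y v) g

theorem SmoothNear.fderiv_apply {g : E → ℝ} {x : E} (hg : SmoothNear g x) (v : E) :
    SmoothNear (fun y => fderiv ℝ g y v) x := by
  filter_upwards [hg] with y hy
  exact (hy.fderiv_right (m := ∞) (by simp)).clm_apply contDiffAt_const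

theorem SmoothNear.listDeriv {g : E → ℝ} {x : E} (hg : SmoothNear g x) (l : List E) :
    SmoothNear (listDeriv g l) x := by
  induction l with
  | nil => exact hg
  | cons v l ih => exact ih.fderiv_apply v

theorem SmoothNear.fderiv_comm {g : E → ℝ} {x : E} (hg : SmoothNear g x) (v w : E) :
    (fun y => fderiv ℝ (fun z => fderiv ℝ g z v) y w) =ᶠ[𝓝 x]
      (fun y => fderiv ℝ (fun z => fderiv ℝ g z w) y v) := by
  filter_upwards [hg] with y hy
  have hd : DifferentiableAt ℝ (fderiv ℝ g) y :=
    (hy.fderiv_right (m := 1) (by norm_cast)).differentiableAt (by simp)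
  have hs : IsSymmSndFDerivAt ℝ g y := hy.isSymmSndFDerivAt (by simpa using WithTop.coe_le_coe.2 (le_top : (2 : ℕ∞) ≤ ⊤))
  have key (a b : E) : fderiv ℝ (fun z => fderiv ℝ g z a) y b = fderiv ℝ (fderiv ℝ g) y b a := by
    have := (hd.hasFDerivAt.clm_apply (hasFDerivAt_const a y)).fderiv
    rw [this]
    simp
  rw [key, key]
  exact hs w v

/-- Adjacent swaps generate all permutations, and each swap is Schwarz's theorem. Equality has to
hold as germs, not only at `x`, because further derivatives are applied on top. -/
theorem SmoothNear.listDeriv_perm {g : E → ℝ} {x : E} (hg : SmoothNear g x) {l l' : List E}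
    (h : l.Perm l') : MixedRestriction.listDeriv g l =ᶠ[𝓝 x] MixedRestriction.listDeriv g l' := by
  induction h with
  | nil => rfl
  | cons v _ ih =>
    filter_upwards [ih.fderiv (𝕜 := ℝ)] with y hy
    exact congrArg (fun A : E →L[ℝ] ℝ => A v) hy
  | swap v w l => exact (hg.listDeriv l).fderiv_comm v w
  | trans _ _ ih₁ ih₂ => exact ih₁.trans ih₂

theorem SmoothNear.iteratedFDeriv_eq_listDeriv {g : E → ℝ} {x : E} (hg : SmoothNear g x) {n : ℕ}
    (v : Fin n → E) :
    (fun y => iteratedFDeriv ℝ n g y v) =ᶠ[𝓝 x] MixedRestriction.listDeriv g (List.ofFn v) := by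
  induction n with
  | zero => exact Eventually.of_forall fun y => by simp [MixedRestriction.listDeriv]
  | succ n ih =>
    filter_upwards [hg, (ih (Fin.tail v)).fderiv (𝕜 := ℝ)] with y hy hy'
    have hd : DifferentiableAt ℝ (iteratedFDeriv ℝ n g) y :=
      hy.differentiableAt_iteratedFDeriv (by exact_mod_cast WithTop.coe_lt_top n)
    rw [hd.iteratedFDeriv_succ_apply_left', hy', List.ofFn_succ]
    rfl

theorem SmoothNear.iteratedFDeriv_comp_perm {g : E → ℝ} {x : E} (hg : SmoothNear g x) {n : ℕ}
    (v : Fin n → E) (σ : Equiv.Perm (Fin n)) :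
    iteratedFDeriv ℝ n g x (v ∘ σ) = iteratedFDeriv ℝ n g x v := by
  rw [(hg.iteratedFDeriv_eq_listDeriv (v ∘ σ)).eq_of_nhds,
    (hg.iteratedFDeriv_eq_listDeriv v).eq_of_nhds]
  exact (hg.listDeriv_perm (σ.ofFn_comp_perm v)).eq_of_nhds

end Symmetry

/-! ### Taylor expansion in two variables -/

theorem partialAtZero_of_add_eq (g : ℝ × ℝ → ℝ) {a b k : ℕ} (h : a + b = k) :
    partialAtZero g (a, b) = iteratedFDeriv ℝ k g 0
      (fun i => if (i : ℕ) < a then ((1, 0) : ℝ × ℝ) else (0, 1)) := by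
  subst h
  rfl

/-- By symmetry only the number of arguments equal to `(1, 0)` matters, whereas `partialAtZero`
fixes an order with these arguments in front. -/
theorem iteratedFDeriv_piecewise {g : ℝ × ℝ → ℝ} (hg : SmoothNear g 0) {k : ℕ}
    (s : Finset (Fin k)) :
    iteratedFDeriv ℝ k g 0 (s.piecewise (fun _ => ((1, 0) : ℝ × ℝ)) (fun _ => (0, 1))) =
      partialAtZero g (s.card, k - s.card) := by
  have hs : s.card ≤ k := by simpa using s.card_le_univ
  rw [partialAtZero_of_add_eq g (Nat.add_sub_of_le hs)]
  have hcard : Fintype.card {i : Fin k // i ∈ s} = Fintype.card {i : Fin k // (i : ℕ) < s.card} := by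
    rw [Fintype.card_coe, Fintype.card_subtype]
    rcases hs.lt_or_eq with h | h
    · have := Fin.card_filter_val_lt (n := k) (m := s.card)
      omega
    · have : (Finset.univ.filter fun i : Fin k => (i : ℕ) < s.card) = Finset.univ := by
        ext i
        simp [h]
      rw [this, Finset.card_univ, Fintype.card_fin, h]
  -- A bijection of `s` with the initial segment of the same size extends to a permutation of all
  -- indices.
  let e := Fintype.equivOfCardEq hcard
  rw [← hg.iteratedFDeriv_comp_perm
    (fun i : Fin k => if (i : ℕ) < s.card then ((1, 0) : ℝ × ℝ) else (0, 1)) e.extendSubtype]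
  congr 1
  funext i
  by_cases hi : i ∈ s
  · have := e.extendSubtype_mem i hi
    simp [hi, this]
  · have := e.extendSubtype_not_mem i hi
    simp only [Finset.piecewise, hi, if_false, Function.comp_apply, this]

theorem iteratedFDeriv_apply_const {g : ℝ × ℝ → ℝ} (hg : SmoothNear g 0) (k : ℕ) (y : ℝ × ℝ) :
    iteratedFDeriv ℝ k g 0 (fun _ => y) =
      ∑ j ∈ Finset.range (k + 1), k.choose j * (y.1 ^ j * y.2 ^ (k - j)) *
        partialAtZero g (j, k - j) := by
  have hy : (fun _ : Fin k => y) =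
      (fun _ => y.1 • ((1, 0) : ℝ × ℝ)) + (fun _ => y.2 • ((0, 1) : ℝ × ℝ)) := by
    funext i
    ext <;> simp
  rw [hy, ContinuousMultilinearMap.map_add_univ]
  have (s : Finset (Fin k)) : iteratedFDeriv ℝ k g 0
      (s.piecewise (fun _ => y.1 • ((1, 0) : ℝ × ℝ)) (fun _ => y.2 • ((0, 1) : ℝ × ℝ))) =
      (y.1 ^ s.card * y.2 ^ (k - s.card)) * partialAtZero g (s.card, k - s.card) := by
    rw [← iteratedFDeriv_piecewise hg s]
    have h : s.piecewise (fun _ => y.1 • ((1, 0) : ℝ × ℝ)) (fun _ => y.2 • ((0, 1) : ℝ × ℝ)) =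
        fun i => (s.piecewise (fun _ => y.1) (fun _ => y.2) i) •
          (s.piecewise (fun _ => ((1, 0) : ℝ × ℝ)) (fun _ => (0, 1)) i) := by
      funext i
      by_cases hi : i ∈ s <;> simp [hi]
    rw [h, ContinuousMultilinearMap.map_smul_univ, Finset.prod_piecewise]
    simp [Finset.card_sdiff]
  simp_rw [this]
  have h2 := Finset.sum_powerset_apply_card
    (fun j => (y.1 ^ j * y.2 ^ (k - j)) * partialAtZero g (j, k - j))
    (x := (Finset.univ : Finset (Fin k)))
  rw [Finset.powerset_univ] at h2
  rw [h2]
  simp [mul_assoc]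

/-- The Taylor coefficient of `g` at the origin belonging to the monomial `y₁^α₁ y₂^α₂`. -/
noncomputable def taylorCoeff (g : ℝ × ℝ → ℝ) (α : ℕ × ℕ) : ℝ :=
  ((α.1 + α.2).factorial : ℝ)⁻¹ * ((α.1 + α.2).choose α.1 * partialAtZero g α)

theorem taylorCoeff_ne_zero {g : ℝ × ℝ → ℝ} {α : ℕ × ℕ} :
    taylorCoeff g α ≠ 0 ↔ α ∈ taylorSupport g := by
  have h1 : ((α.1 + α.2).factorial : ℝ)⁻¹ ≠ 0 := by positivity
  have h2 : ((α.1 + α.2).choose α.1 : ℝ) ≠ 0 := by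
    exact_mod_cast (Nat.choose_pos (Nat.le_add_right _ _)).ne'
  simp [taylorCoeff, taylorSupport, h2, Nat.factorial_ne_zero]

/-- The multi-indices of order less than `M`. -/
def indicesBelow (M : ℕ) : Finset (ℕ × ℕ) :=
  (Finset.range M).biUnion fun k => Finset.HasAntidiagonal.antidiagonal k

theorem mem_indicesBelow {M : ℕ} {α : ℕ × ℕ} : α ∈ indicesBelow M ↔ α.1 + α.2 < M := by
  simp [indicesBelow]

theorem sum_indicesBelow (M : ℕ) (f : ℕ × ℕ → ℝ) :
    ∑ α ∈ indicesBelow M, f α =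
      ∑ k ∈ Finset.range M, ∑ j ∈ Finset.range (k + 1), f (j, k - j) := by
  rw [indicesBelow, Finset.sum_biUnion]
  · exact Finset.sum_congr rfl fun k _ => Finset.Nat.sum_antidiagonal_eq_sum_range_succ_mk _ _
  · intro a _ b _ hab
    refine Finset.disjoint_left.mpr fun α ha hb => hab ?_
    simp only [Finset.HasAntidiagonal.mem_antidiagonal] at ha hb
    omega

theorem SmoothNear.taylor_bound {g : ℝ × ℝ → ℝ} (hg : SmoothNear g 0) (n : ℕ) :
    ∃ C, 0 ≤ C ∧ ∀ᶠ y in 𝓝 (0 : ℝ × ℝ),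
      |g y - ∑ α ∈ indicesBelow (n + 1), taylorCoeff g α * (y.1 ^ α.1 * y.2 ^ α.2)| ≤
        C * ‖y‖ ^ (n + 1) := by
  have hc : ContinuousAt (fun y => ‖iteratedFDeriv ℝ (n + 1) g y‖) 0 :=
    (((hg.contDiffAt.of_le (m := (n + 1 : ℕ)) (by exact_mod_cast le_top)).iteratedFDeriv_right
      (i := n + 1) (m := 0) (by simp)).continuousAt).norm
  set B := ‖iteratedFDeriv ℝ (n + 1) g 0‖ + 1 with hB
  have hev : ∀ᶠ y in 𝓝 (0 : ℝ × ℝ), ContDiffAt ℝ (n + 1) g y ∧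
      ‖iteratedFDeriv ℝ (n + 1) g y‖ ≤ B := by
    filter_upwards [hg, hc.eventually (eventually_le_nhds (b := B) (by simp [hB]))] with y h1 h2
    exact ⟨h1.of_le (by exact_mod_cast le_top), h2⟩
  obtain ⟨δ, hδ, hball⟩ := Metric.eventually_nhds_iff_ball.mp hev
  refine ⟨B, by positivity, ?_⟩
  filter_upwards [Metric.ball_mem_nhds (0 : ℝ × ℝ) hδ] with y hy
  have hseg (t : ℝ) (ht : t ∈ Icc (0 : ℝ) 1) : (0 : ℝ × ℝ) + t • y ∈ Metric.ball (0 : ℝ × ℝ) δ := by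
    rw [mem_ball_zero_iff] at hy ⊢
    rw [zero_add, norm_smul, Real.norm_of_nonneg ht.1]
    exact (mul_le_of_le_one_left (norm_nonneg _) ht.2).trans_lt hy
  have hT := map_add_eq_sum_add_integral_iteratedFDeriv (f := g) (x := 0) (y := y) (n := n)
    fun t ht => (hball _ (hseg t ht)).1
  rw [zero_add] at hT
  have hsum : ∑ α ∈ indicesBelow (n + 1), taylorCoeff g α * (y.1 ^ α.1 * y.2 ^ α.2) =
      ∑ k ∈ Finset.range (n + 1), (k.factorial : ℝ)⁻¹ • iteratedFDeriv ℝ k g 0 (fun _ => y) := by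
    rw [sum_indicesBelow]
    refine Finset.sum_congr rfl fun k _ => ?_
    rw [iteratedFDeriv_apply_const hg, smul_eq_mul, Finset.mul_sum]
    refine Finset.sum_congr rfl fun j hj => ?_
    have : j + (k - j) = k := by simp at hj; omega
    simp only [taylorCoeff, this]
    ring
  rw [hsum, hT, add_sub_cancel_left, smul_eq_mul, abs_mul]
  have hint : |∫ t in (0 : ℝ)..1, (1 - t) ^ n • iteratedFDeriv ℝ (n + 1) g (0 + t • y) (fun _ => y)|
      ≤ B * ‖y‖ ^ (n + 1) := by
    have := intervalIntegral.norm_integral_le_of_norm_le_const (a := 0) (b := 1)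
      (C := B * ‖y‖ ^ (n + 1))
      (f := fun t : ℝ => (1 - t) ^ n • iteratedFDeriv ℝ (n + 1) g (0 + t • y) (fun _ => y)) ?_
    · simpa using this
    intro t ht
    rw [uIoc_of_le zero_le_one] at ht
    have ht' : t ∈ Icc (0 : ℝ) 1 := ⟨ht.1.le, ht.2⟩
    rw [norm_smul, norm_pow, Real.norm_of_nonneg (by linarith [ht.2])]
    have h1 : (1 - t) ^ n ≤ 1 := pow_le_one₀ (by linarith [ht.2]) (by linarith [ht.1])
    have h2 : ‖iteratedFDeriv ℝ (n + 1) g (0 + t • y) (fun _ => y)‖ ≤ B * ‖y‖ ^ (n + 1) := by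
      refine (ContinuousMultilinearMap.le_opNorm _ _).trans ?_
      rw [Finset.prod_const, Finset.card_univ, Fintype.card_fin]
      gcongr
      exact (hball _ (hseg t ht')).2
    exact (mul_le_of_le_one_left (norm_nonneg _) h1).trans h2
  have hf : |((n.factorial : ℝ))⁻¹| ≤ 1 := by
    rw [abs_of_nonneg (by positivity)]
    exact inv_le_one_of_one_le₀ (by exact_mod_cast n.factorial_pos)
  exact (mul_le_of_le_one_left (abs_nonneg _) hf).trans hint

/-! ### Growth on anisotropic boxes and the Taylor support -/

theorem tendsto_rpow_nhdsGT_zero {a : ℝ} (ha : 0 < a) :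
    Tendsto (fun ε : ℝ => ε ^ a) (𝓝[>] 0) (𝓝 0) := by
  have := (Real.continuousAt_rpow_const 0 a (Or.inr ha.le)).tendsto
  rw [Real.zero_rpow ha.ne'] at this
  exact this.mono_left nhdsWithin_le_nhds

theorem eventually_lt_one_nhdsGT : ∀ᶠ ε : ℝ in 𝓝[>] 0, 0 < ε ∧ ε < 1 := by
  filter_upwards [Ioo_mem_nhdsGT (zero_lt_one (α := ℝ))] with ε hε using hε

theorem rpow_mul_rpow_pow {ε : ℝ} (hε : 0 < ε) (u v : ℝ) (a b : ℕ) :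
    (ε ^ u) ^ a * (ε ^ v) ^ b = ε ^ (u * a + v * b) := by
  rw [Real.rpow_add hε, Real.rpow_mul hε.le, Real.rpow_mul hε.le, Real.rpow_natCast,
    Real.rpow_natCast]

/-- Each Taylor monomial has size `ε` to the power of its weight, and the Taylor order is taken so
large that the remainder is also `O(ε^r)`. -/
theorem SmoothNear.growth {g : ℝ × ℝ → ℝ} (hg : SmoothNear g 0) {u v r : ℝ} (hu : 0 < u)
    (hv : 0 < v) (hs : ∀ α ∈ taylorSupport g, r ≤ u * α.1 + v * α.2) {A : ℝ} (hA : 0 ≤ A) :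
    ∃ C, 0 ≤ C ∧ ∀ᶠ ε in 𝓝[>] (0 : ℝ), ∀ y : ℝ × ℝ, |y.1| ≤ A * ε ^ u → |y.2| ≤ A * ε ^ v →
      |g y| ≤ C * ε ^ r := by
  set w := min u v with hw
  have hw0 : 0 < w := lt_min hu hv
  obtain ⟨n, hn⟩ := exists_nat_gt (r / w)
  have hn' : r ≤ w * (n + 1 : ℕ) := by
    rw [div_lt_iff₀ hw0] at hn
    push_cast
    nlinarith
  obtain ⟨C, hC, hT⟩ := hg.taylor_bound n
  obtain ⟨δ, hδ, hball⟩ := Metric.eventually_nhds_iff_ball.mp hT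
  refine ⟨∑ α ∈ indicesBelow (n + 1), |taylorCoeff g α| * (A ^ α.1 * A ^ α.2) + C * A ^ (n + 1),
    by positivity, ?_⟩
  have hlim (a : ℝ) (ha : 0 < a) : ∀ᶠ ε in 𝓝[>] (0 : ℝ), A * ε ^ a < δ := by
    have := (tendsto_rpow_nhdsGT_zero ha).const_mul A
    rw [mul_zero] at this
    exact this.eventually (gt_mem_nhds hδ)
  filter_upwards [hlim w hw0, eventually_lt_one_nhdsGT] with ε h1 h3 y hy1 hy2
  obtain ⟨hε, hε1⟩ := h3
  have hmono {a b : ℝ} (h : a ≤ b) : ε ^ b ≤ ε ^ a := Real.rpow_le_rpow_of_exponent_ge hε hε1.le h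
  have hy : ‖y‖ ≤ A * ε ^ w := by
    rw [Prod.norm_def, Real.norm_eq_abs, Real.norm_eq_abs]
    refine max_le (hy1.trans ?_) (hy2.trans ?_)
    · exact mul_le_mul_of_nonneg_left (hmono (min_le_left _ _)) hA
    · exact mul_le_mul_of_nonneg_left (hmono (min_le_right _ _)) hA
  have hb := hball y (by rw [mem_ball_zero_iff]; exact hy.trans_lt h1)
  have hrem : C * ‖y‖ ^ (n + 1) ≤ C * A ^ (n + 1) * ε ^ r := by
    have : ‖y‖ ^ (n + 1) ≤ A ^ (n + 1) * ε ^ r := by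
      refine (pow_le_pow_left₀ (norm_nonneg _) hy _).trans ?_
      rw [mul_pow, ← Real.rpow_natCast (ε ^ w), ← Real.rpow_mul hε.le]
      exact mul_le_mul_of_nonneg_left (hmono hn') (by positivity)
    rw [mul_assoc]
    exact mul_le_mul_of_nonneg_left this hC
  have hsum : |∑ α ∈ indicesBelow (n + 1), taylorCoeff g α * (y.1 ^ α.1 * y.2 ^ α.2)| ≤
      (∑ α ∈ indicesBelow (n + 1), |taylorCoeff g α| * (A ^ α.1 * A ^ α.2)) * ε ^ r := by
    rw [Finset.sum_mul]
    refine (Finset.abs_sum_le_sum_abs _ _).trans (Finset.sum_le_sum fun α _ => ?_)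
    by_cases hα : taylorCoeff g α = 0
    · simp [hα]
    rw [abs_mul, abs_mul, abs_pow, abs_pow, mul_assoc]
    refine mul_le_mul_of_nonneg_left ?_ (abs_nonneg _)
    calc |y.1| ^ α.1 * |y.2| ^ α.2 ≤ (A * ε ^ u) ^ α.1 * (A * ε ^ v) ^ α.2 := by gcongr
      _ = A ^ α.1 * A ^ α.2 * ((ε ^ u) ^ α.1 * (ε ^ v) ^ α.2) := by rw [mul_pow, mul_pow]; ring
      _ ≤ A ^ α.1 * A ^ α.2 * ε ^ r := by
        rw [rpow_mul_rpow_pow hε]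
        exact mul_le_mul_of_nonneg_left (hmono (hs α (taylorCoeff_ne_zero.mp hα))) (by positivity)
  calc |g y| = |(g y - ∑ α ∈ indicesBelow (n + 1), taylorCoeff g α * (y.1 ^ α.1 * y.2 ^ α.2)) +
        ∑ α ∈ indicesBelow (n + 1), taylorCoeff g α * (y.1 ^ α.1 * y.2 ^ α.2)| := by
          rw [sub_add_cancel]
    _ ≤ _ := abs_add_le _ _
    _ ≤ C * A ^ (n + 1) * ε ^ r + _ := add_le_add (hb.trans hrem) hsum
    _ = _ := by ring

/-- The leading quasi-homogeneous part of a smooth function, restricted to the line `y₁ = 1`. -/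
theorem SmoothNear.exists_edgePolynomial {g : ℝ × ℝ → ℝ} (hg : SmoothNear g 0) {u v r : ℝ}
    (hu : 0 < u) (hv : 0 < v) (hs : ∀ α ∈ taylorSupport g, r ≤ u * α.1 + v * α.2) :
    ∃ p : Polynomial ℝ,
      (∀ α : ℕ × ℕ, u * α.1 + v * α.2 = r → p.coeff α.2 = taylorCoeff g α) ∧
      (∀ j, p.coeff j ≠ 0 → ∃ α ∈ taylorSupport g, α.2 = j ∧ u * α.1 + v * α.2 = r) ∧
      ∀ (y : ℝ) (z : ℝ → ℝ), Tendsto z (𝓝[>] 0) (𝓝 y) →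
        Tendsto (fun ε => ε ^ (-r) * g (ε ^ u, ε ^ v * z ε)) (𝓝[>] 0) (𝓝 (p.eval y)) := by
  classical
  set w := min u v with hw
  have hw0 : 0 < w := lt_min hu hv
  -- With this order the remainder, `O(ε^(w(n+1)))`, is of strictly smaller size than `ε^r`, and
  -- every index of weight exactly `r` has order at most `n`.
  obtain ⟨n, hn⟩ := exists_nat_gt (r / w)
  have hn' : r < w * (n + 1 : ℕ) := by
    rw [div_lt_iff₀ hw0] at hn
    push_cast
    nlinarith
  set F := (indicesBelow (n + 1)).filter fun α => u * α.1 + v * α.2 = r with hF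
  have hmemF (α : ℕ × ℕ) (hα : u * α.1 + v * α.2 = r) : α ∈ F := by
    rw [hF, Finset.mem_filter, mem_indicesBelow]
    refine ⟨?_, hα⟩
    have h1 : w * ((α.1 + α.2 : ℕ) : ℝ) ≤ r := by
      rw [← hα]
      push_cast
      rw [mul_add]
      gcongr
      · exact min_le_left _ _
      · exact min_le_right _ _
    exact_mod_cast lt_of_mul_lt_mul_left (h1.trans_lt hn') hw0.le
  have hinj (α β : ℕ × ℕ) (hα : u * α.1 + v * α.2 = r) (hβ : u * β.1 + v * β.2 = r)
      (h : α.2 = β.2) : α = β := by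
    have : u * (α.1 : ℝ) = u * β.1 := by rw [h] at hα; linarith
    exact Prod.ext (by exact_mod_cast mul_left_cancel₀ hu.ne' this) h
  refine ⟨∑ α ∈ F, Polynomial.monomial α.2 (taylorCoeff g α), ?_, ?_, ?_⟩
  · intro α hα
    rw [Polynomial.finsetSum_coeff, Finset.sum_eq_single α]
    · simp
    · intro β hβ hne
      rw [Polynomial.coeff_monomial, if_neg]
      exact fun h => hne (hinj β α (Finset.mem_filter.mp hβ).2 hα h)
    · exact fun h => absurd (hmemF α hα) h
  · intro j hj
    rw [Polynomial.finsetSum_coeff] at hj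
    obtain ⟨α, hα, hne⟩ := Finset.exists_ne_zero_of_sum_ne_zero hj
    rw [Polynomial.coeff_monomial] at hne
    have h2 : α.2 = j := by by_contra h; simp [h] at hne
    rw [if_pos h2] at hne
    exact ⟨α, taylorCoeff_ne_zero.mp hne, h2, (Finset.mem_filter.mp hα).2⟩
  · intro y z hz
    obtain ⟨C, hC, hT⟩ := hg.taylor_bound n
    obtain ⟨δ, hδ, hball⟩ := Metric.eventually_nhds_iff_ball.mp hT
    set S : ℝ × ℝ → ℝ :=
      fun x => ∑ α ∈ indicesBelow (n + 1), taylorCoeff g α * (x.1 ^ α.1 * x.2 ^ α.2) with hS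
    have hmain : Tendsto (fun ε => ε ^ (-r) * S (ε ^ u, ε ^ v * z ε)) (𝓝[>] 0)
        (𝓝 (Polynomial.eval y (∑ α ∈ F, Polynomial.monomial α.2 (taylorCoeff g α)))) := by
      simp only [hS, Finset.mul_sum, Polynomial.eval_finsetSum, hF, Finset.sum_filter]
      refine tendsto_finsetSum _ fun α _ => ?_
      have heq : (fun ε : ℝ => taylorCoeff g α * (ε ^ (u * α.1 + v * α.2 - r) * z ε ^ α.2))
          =ᶠ[𝓝[>] 0] fun ε =>
            ε ^ (-r) * (taylorCoeff g α * ((ε ^ u) ^ α.1 * (ε ^ v * z ε) ^ α.2)) := by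
        filter_upwards [eventually_lt_one_nhdsGT] with ε hε
        rw [sub_eq_add_neg, Real.rpow_add hε.1, ← rpow_mul_rpow_pow hε.1, mul_pow]
        ring
      refine Tendsto.congr' heq ?_
      split_ifs with h
      · simpa [h] using (hz.pow α.2).const_mul (taylorCoeff g α)
      by_cases hα : taylorCoeff g α = 0
      · simp [hα]
      have hpos : 0 < u * α.1 + v * α.2 - r := by
        have := hs α (taylorCoeff_ne_zero.mp hα)
        exact sub_pos.mpr (lt_of_le_of_ne this (Ne.symm h))
      simpa using ((tendsto_rpow_nhdsGT_zero hpos).mul (hz.pow α.2)).const_mul (taylorCoeff g α)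
    have hrem : Tendsto (fun ε => ε ^ (-r) * (g (ε ^ u, ε ^ v * z ε) - S (ε ^ u, ε ^ v * z ε)))
        (𝓝[>] 0) (𝓝 0) := by
      set A := |y| + 1 with hA
      have hA0 : 0 ≤ A := by positivity
      have hzA : ∀ᶠ ε in 𝓝[>] (0 : ℝ), |z ε| ≤ A :=
        hz.abs.eventually (eventually_le_nhds (by simp [hA]))
      have hlim : ∀ᶠ ε in 𝓝[>] (0 : ℝ), A * ε ^ w < δ := by
        have := (tendsto_rpow_nhdsGT_zero hw0).const_mul A
        rw [mul_zero] at this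
        exact this.eventually (gt_mem_nhds hδ)
      have hb : Tendsto (fun ε : ℝ => C * A ^ (n + 1) * ε ^ (w * (n + 1 : ℕ) - r))
          (𝓝[>] 0) (𝓝 0) := by
        simpa using (tendsto_rpow_nhdsGT_zero (sub_pos.mpr hn')).const_mul (C * A ^ (n + 1))
      refine squeeze_zero_norm' ?_ hb
      filter_upwards [hzA, hlim, eventually_lt_one_nhdsGT] with ε h1 h2 h3
      obtain ⟨hε, hε1⟩ := h3
      have hmono {a b : ℝ} (h : a ≤ b) : ε ^ b ≤ ε ^ a :=
        Real.rpow_le_rpow_of_exponent_ge hε hε1.le h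
      have hy : ‖((ε ^ u, ε ^ v * z ε) : ℝ × ℝ)‖ ≤ A * ε ^ w := by
        rw [Prod.norm_def, Real.norm_eq_abs, Real.norm_eq_abs]
        refine max_le ?_ ?_
        · rw [abs_of_pos (Real.rpow_pos_of_pos hε _)]
          refine (hmono (min_le_left u v)).trans ?_
          exact le_mul_of_one_le_left (Real.rpow_nonneg hε.le _) (by simp [hA])
        · rw [abs_mul, abs_of_pos (Real.rpow_pos_of_pos hε _), mul_comm]
          exact mul_le_mul h1 (hmono (min_le_right u v)) (Real.rpow_nonneg hε.le _) hA0
      have hb := hball _ (by rw [mem_ball_zero_iff]; exact hy.trans_lt h2)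
      rw [norm_mul, Real.norm_of_nonneg (Real.rpow_nonneg hε.le _), Real.norm_eq_abs]
      calc ε ^ (-r) * |g (ε ^ u, ε ^ v * z ε) - S (ε ^ u, ε ^ v * z ε)|
          ≤ ε ^ (-r) * (C * (A * ε ^ w) ^ (n + 1)) := by
            refine mul_le_mul_of_nonneg_left (hb.trans ?_) (Real.rpow_nonneg hε.le _)
            gcongr
        _ = C * A ^ (n + 1) * ε ^ (w * (n + 1 : ℕ) - r) := by
            rw [mul_pow, ← Real.rpow_natCast (ε ^ w), ← Real.rpow_mul hε.le, sub_eq_add_neg,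
              Real.rpow_add hε]
            ring
    have := hmain.add hrem
    rw [add_zero] at this
    refine this.congr fun ε => ?_
    ring

/-- For positive weights only finitely many indices lie below a given level, so the infimum is
attained. -/
theorem exists_minimal_weight {s : Set (ℕ × ℕ)} (hs : s.Nonempty) {u v : ℝ} (hu : 0 < u)
    (hv : 0 < v) : ∃ α ∈ s, ∀ β ∈ s, u * α.1 + v * α.2 ≤ u * β.1 + v * β.2 := by
  obtain ⟨α₀, hα₀⟩ := hs
  obtain ⟨M, hM⟩ := exists_nat_gt ((u * α₀.1 + v * α₀.2) / min u v)
  have hw0 : 0 < min u v := lt_min hu hv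
  rw [div_lt_iff₀ hw0] at hM
  classical
  have hmem (β : ℕ × ℕ) (hβ : u * β.1 + v * β.2 ≤ u * α₀.1 + v * α₀.2) : β ∈ indicesBelow M := by
    rw [mem_indicesBelow]
    have h1 : ((β.1 + β.2 : ℕ) : ℝ) * min u v ≤ u * β.1 + v * β.2 := by
      push_cast
      rw [add_mul, mul_comm u, mul_comm v]
      gcongr
      · exact min_le_left _ _
      · exact min_le_right _ _
    exact_mod_cast lt_of_mul_lt_mul_right ((h1.trans hβ).trans_lt hM) hw0.le
  obtain ⟨α, hα, hmin⟩ := ((indicesBelow M).filter (· ∈ s)).exists_min_image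
    (fun β => u * β.1 + v * β.2) ⟨α₀, by simp [hα₀, hmem α₀ le_rfl]⟩
  rw [Finset.mem_filter] at hα
  refine ⟨α, hα.2, fun β hβ => ?_⟩
  by_cases h : β ∈ indicesBelow M
  · exact hmin β (by simp [h, hβ])
  · have h0 := hmin α₀ (by simp [hα₀, hmem α₀ le_rfl])
    exact h0.trans (le_of_lt (not_le.mp fun h' => h (hmem β h')))

/-- Converse of `SmoothNear.growth`: if the minimal weight were below `r`, rescaling by it would
make the edge polynomial vanish at every `y`, although the minimising index contributes a nonzero
coefficient. -/
theorem SmoothNear.le_weight_of_growth {g : ℝ × ℝ → ℝ} (hg : SmoothNear g 0) {u v r : ℝ}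
    (hu : 0 < u) (hv : 0 < v)
    (hgr : ∀ y : ℝ, ∃ C, ∀ᶠ ε in 𝓝[>] (0 : ℝ), |g (ε ^ u, ε ^ v * y)| ≤ C * ε ^ r) :
    ∀ α ∈ taylorSupport g, r ≤ u * α.1 + v * α.2 := by
  intro β hβ
  obtain ⟨α, hα, hmin⟩ := exists_minimal_weight ⟨β, hβ⟩ hu hv
  refine le_trans ?_ (hmin β hβ)
  by_contra! hlt
  obtain ⟨p, hp1, -, hp3⟩ := hg.exists_edgePolynomial hu hv hmin
  have hp0 : p = 0 := by
    refine Polynomial.funext fun y => ?_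
    obtain ⟨C, hC⟩ := hgr y
    rw [Polynomial.eval_zero]
    refine tendsto_nhds_unique (hp3 y (fun _ => y) tendsto_const_nhds) ?_
    have hb : Tendsto (fun ε : ℝ => C * ε ^ (r - (u * α.1 + v * α.2))) (𝓝[>] 0) (𝓝 0) := by
      simpa using (tendsto_rpow_nhdsGT_zero (sub_pos.mpr hlt)).const_mul C
    refine squeeze_zero_norm' ?_ hb
    filter_upwards [hC, eventually_lt_one_nhdsGT] with ε h1 h2
    rw [norm_mul, Real.norm_of_nonneg (Real.rpow_nonneg h2.1.le _), Real.norm_eq_abs,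
      sub_eq_add_neg, Real.rpow_add h2.1]
    calc _ ≤ ε ^ (-(u * α.1 + v * α.2)) * (C * ε ^ r) :=
          mul_le_mul_of_nonneg_left h1 (Real.rpow_nonneg h2.1.le _)
      _ = _ := by ring
  have := hp1 α rfl
  rw [hp0, Polynomial.coeff_zero] at this
  exact taylorCoeff_ne_zero.mpr hα this.symm

/-! ### Newton polyhedra and half planes -/

theorem convex_weight_ge (u v r : ℝ) : Convex ℝ {t : ℝ × ℝ | r ≤ u * t.1 + v * t.2} := by
  intro x hx y hy a b ha hb hab
  simp only [mem_ofPred_eq, Prod.fst_add, Prod.smul_fst, Prod.snd_add, Prod.smul_snd,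
    smul_eq_mul] at *
  calc r = a * r + b * r := by rw [← add_mul, hab, one_mul]
    _ ≤ a * (u * x.1 + v * x.2) + b * (u * y.1 + v * y.2) := by gcongr
    _ = _ := by ring

theorem mem_newtonPolyhedron {g : ℝ × ℝ → ℝ} {α : ℕ × ℕ} (hα : α ∈ taylorSupport g) :
    ((α.1 : ℝ), (α.2 : ℝ)) ∈ newtonPolyhedron g :=
  subset_convexHull _ _ (mem_biUnion hα ⟨le_rfl, le_rfl⟩)

theorem le_weight_of_mem_newtonPolyhedron {g : ℝ × ℝ → ℝ} {u v r : ℝ} (hu : 0 ≤ u) (hv : 0 ≤ v)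
    (h : ∀ α ∈ taylorSupport g, r ≤ u * α.1 + v * α.2) {t : ℝ × ℝ} (ht : t ∈ newtonPolyhedron g) :
    r ≤ u * t.1 + v * t.2 := by
  refine convexHull_min (iUnion₂_subset fun α hα => ?_) (convex_weight_ge u v r) ht
  intro s hs
  have := h α hα
  have h1 := mul_le_mul_of_nonneg_left hs.1 hu
  have h2 := mul_le_mul_of_nonneg_left hs.2 hv
  show r ≤ u * s.1 + v * s.2
  linarith

theorem nonneg_of_diag_mem {g : ℝ × ℝ → ℝ} {t : ℝ} (ht : (t, t) ∈ newtonPolyhedron g) : 0 ≤ t := by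
  have := le_weight_of_mem_newtonPolyhedron (g := g) (u := 1) (v := 0) (r := 0) zero_le_one le_rfl
    (fun α _ => by positivity) ht
  simpa using this

theorem bddBelow_diag (g : ℝ × ℝ → ℝ) : BddBelow {t : ℝ | (t, t) ∈ newtonPolyhedron g} :=
  ⟨0, fun _ ht => nonneg_of_diag_mem ht⟩

/-- A segment on a line `t₁ + n t₂ = D` that meets the bisectrix bounds the Newton distance. -/
theorem newtonDistance_le_of_segment {g : ℝ × ℝ → ℝ} {α β : ℕ × ℕ} (hα : α ∈ taylorSupport g)
    (hβ : β ∈ taylorSupport g) {n D : ℝ} (hn : 0 < n) (hαD : (α.1 : ℝ) + n * α.2 = D)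
    (hβD : (β.1 : ℝ) + n * β.2 = D) (h1 : (α.2 : ℝ) ≤ D / (1 + n)) (h2 : D / (1 + n) ≤ β.2) :
    newtonDistance g ≤ D / (1 + n) := by
  refine csInf_le (bddBelow_diag g) ?_
  have hconv : Convex ℝ (newtonPolyhedron g) := convex_convexHull _ _
  set e := D / (1 + n) with he
  have heD : e + n * e = D := by rw [he]; field_simp
  rcases h1.eq_or_lt with h | h
  · have h1' : (α.1 : ℝ) = e := by rw [h] at hαD; linarith
    have := mem_newtonPolyhedron hα
    rwa [h, h1'] at this
  have hlt : (0 : ℝ) < β.2 - α.2 := by linarith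
  have hmem := hconv (mem_newtonPolyhedron hα) (mem_newtonPolyhedron hβ)
    (a := (β.2 - e) / (β.2 - α.2)) (b := (e - α.2) / (β.2 - α.2))
    (div_nonneg (by linarith) hlt.le) (div_nonneg (by linarith) hlt.le)
    (by rw [← add_div, div_eq_one_iff_eq hlt.ne']; ring)
  have hα1 : (α.1 : ℝ) = D - n * α.2 := by linarith
  have hβ1 : (β.1 : ℝ) = D - n * β.2 := by linarith
  change (e, e) ∈ newtonPolyhedron g
  convert hmem using 1
  ext
  · simp only [Prod.fst_add, Prod.smul_fst, smul_eq_mul, hα1, hβ1]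
    field_simp
    rw [← heD]
    ring
  · simp only [Prod.snd_add, Prod.smul_snd, smul_eq_mul]
    field_simp
    ring

/-! ### Shears -/

theorem SmoothNear.shear {g : ℝ × ℝ → ℝ} {ψ : ℝ → ℝ} (hg : SmoothNear g 0) (hψ : SmoothNear ψ 0)
    (hψ0 : ψ 0 = 0) : SmoothNear (MixedRestriction.shear g ψ) 0 := by
  have hfst : Tendsto (Prod.fst : ℝ × ℝ → ℝ) (𝓝 0) (𝓝 0) := continuous_fst.tendsto _
  have hS : ∀ᶠ y : ℝ × ℝ in 𝓝 0, ContDiffAt ℝ ∞ (fun y : ℝ × ℝ => (y.1, y.2 + ψ y.1)) y := by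
    filter_upwards [hfst.eventually hψ] with y hy
    exact contDiffAt_fst.prodMk (contDiffAt_snd.add (hy.comp y contDiffAt_fst))
  have hS0 : Tendsto (fun y : ℝ × ℝ => (y.1, y.2 + ψ y.1)) (𝓝 0) (𝓝 0) := by
    have := hS.self_of_nhds.continuousAt.tendsto
    simpa [hψ0, ← Prod.zero_eq_mk] using this
  filter_upwards [hS, hS0.eventually hg] with y h1 h2
  exact h2.comp y h1

theorem shear_shear_neg (g : ℝ × ℝ → ℝ) (ψ : ℝ → ℝ) :
    shear (shear g ψ) (fun s => -ψ s) = g := by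
  funext y
  simp [shear]

/-- When `ψ = O(|s|^(v/u))`, the shear maps boxes of size `ε^u × ε^v` into boxes of comparable size,
so the growth rate is preserved. -/
theorem le_weight_shear {g : ℝ × ℝ → ℝ} {ψ : ℝ → ℝ} (hg : SmoothNear g 0) (hψ : SmoothNear ψ 0)
    (hψ0 : ψ 0 = 0) {u v r B : ℝ} (hu : 0 < u) (hv : 0 < v) (hB : 0 ≤ B)
    (hψB : ∀ᶠ s in 𝓝 (0 : ℝ), |ψ s| ≤ B * |s| ^ (v / u))
    (hs : ∀ α ∈ taylorSupport g, r ≤ u * α.1 + v * α.2) :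
    ∀ α ∈ taylorSupport (shear g ψ), r ≤ u * α.1 + v * α.2 := by
  refine (hg.shear hψ hψ0).le_weight_of_growth hu hv fun y => ?_
  obtain ⟨C, -, hC⟩ := hg.growth hu hv hs (A := 1 + |y| + B) (by positivity)
  refine ⟨C, ?_⟩
  filter_upwards [hC, eventually_lt_one_nhdsGT, (tendsto_rpow_nhdsGT_zero hu).eventually hψB]
    with ε h1 h2 h3
  have hεv := Real.rpow_pos_of_pos h2.1 v
  have hεu := Real.rpow_pos_of_pos h2.1 u
  rw [abs_of_pos hεu, ← Real.rpow_mul h2.1.le, mul_div_cancel₀ _ hu.ne'] at h3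
  refine h1 (ε ^ u, ε ^ v * y + ψ (ε ^ u)) ?_ ?_
  · rw [abs_of_pos hεu]
    exact le_mul_of_one_le_left hεu.le (by linarith [abs_nonneg y])
  · refine (abs_add_le _ _).trans ?_
    rw [abs_mul, abs_of_pos hεv]
    nlinarith

/-- Either `ψ` vanishes to order `N` at the origin, or it has a leading monomial of lower order. -/
theorem SmoothNear.order_dichotomy {ψ : ℝ → ℝ} (hψ : SmoothNear ψ 0) (N : ℕ) :
    (∃ B, 0 ≤ B ∧ ∀ᶠ s in 𝓝 (0 : ℝ), |ψ s| ≤ B * |s| ^ N) ∨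
      ∃ n < N, ∃ c : ℝ, c ≠ 0 ∧ (∃ B, 0 ≤ B ∧ ∀ᶠ s in 𝓝 (0 : ℝ), |ψ s| ≤ B * |s| ^ n) ∧
        Tendsto (fun ε => ψ ε / ε ^ n) (𝓝[>] 0) (𝓝 c) := by
  classical
  -- Viewing `ψ` as a function of two variables reuses the Taylor bound above.
  have hg : SmoothNear (fun y : ℝ × ℝ => ψ y.1) 0 := by
    have hfst : Tendsto (Prod.fst : ℝ × ℝ → ℝ) (𝓝 0) (𝓝 0) := continuous_fst.tendsto _
    filter_upwards [hfst.eventually hψ] with y hy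
    exact hy.comp y contDiffAt_fst
  set a : ℕ → ℝ := fun j => taylorCoeff (fun y : ℝ × ℝ => ψ y.1) (j, 0) with ha
  have hT (n : ℕ) : ∃ C, 0 ≤ C ∧ ∀ᶠ s in 𝓝 (0 : ℝ),
      |ψ s - ∑ j ∈ Finset.range (n + 1), a j * s ^ j| ≤ C * |s| ^ (n + 1) := by
    obtain ⟨C, hC, h⟩ := hg.taylor_bound n
    refine ⟨C, hC, ?_⟩
    have hι : Tendsto (fun s : ℝ => (s, (0 : ℝ))) (𝓝 0) (𝓝 (0 : ℝ × ℝ)) :=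
      (by fun_prop : Continuous fun s : ℝ => (s, (0 : ℝ))).tendsto _
    filter_upwards [hι.eventually h] with s hs
    have hnorm : ‖((s, 0) : ℝ × ℝ)‖ = |s| := by simp [Prod.norm_def]
    rw [hnorm, sum_indicesBelow] at hs
    convert hs using 3
    refine Finset.sum_congr rfl fun k _ => ?_
    rw [Finset.sum_eq_single k]
    · simp [ha]
    · intro j hj hjk
      have : k - j ≠ 0 := by simp at hj; omega
      simp [this]
    · simp
  by_cases hall : ∀ j < N, a j = 0
  · left
    rcases N with _ | N
    · have hc : Tendsto (fun s => |ψ s|) (𝓝 0) (𝓝 |ψ 0|) := hψ.contDiffAt.continuousAt.abs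
      refine ⟨|ψ 0| + 1, by positivity, ?_⟩
      filter_upwards [hc.eventually (eventually_le_nhds (lt_add_one _))] with s hs
      simpa using hs
    · obtain ⟨C, hC, h⟩ := hT N
      refine ⟨C, hC, ?_⟩
      filter_upwards [h] with s hs
      rwa [Finset.sum_eq_zero fun j hj => by rw [hall j (by simpa using hj), zero_mul],
        sub_zero] at hs
  · right
    push Not at hall
    set n := Nat.find hall with hn
    obtain ⟨hnN, hcn⟩ := Nat.find_spec hall
    have hlow (j : ℕ) (hj : j < n) : a j = 0 := by
      by_contra h
      exact Nat.find_min hall hj ⟨hj.trans hnN, h⟩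
    obtain ⟨C, hC, h⟩ := hT n
    have h' : ∀ᶠ s in 𝓝 (0 : ℝ), |ψ s - a n * s ^ n| ≤ C * |s| ^ (n + 1) := by
      filter_upwards [h] with s hs
      rwa [Finset.sum_range_succ, Finset.sum_eq_zero fun j hj => by
        rw [hlow j (by simpa using hj), zero_mul], zero_add] at hs
    refine ⟨n, hnN, a n, hcn, ⟨C + |a n|, by positivity, ?_⟩, ?_⟩
    · filter_upwards [h', Metric.ball_mem_nhds (0 : ℝ) one_pos] with s hs hs1
      rw [mem_ball_zero_iff, Real.norm_eq_abs] at hs1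
      have h1 : |ψ s| ≤ |ψ s - a n * s ^ n| + |a n * s ^ n| := by
        simpa using abs_add_le (ψ s - a n * s ^ n) (a n * s ^ n)
      rw [abs_mul, abs_pow] at h1
      have h2 : |s| ^ (n + 1) ≤ |s| ^ n :=
        pow_le_pow_of_le_one (abs_nonneg _) hs1.le (Nat.le_succ n)
      nlinarith
    · rw [tendsto_iff_norm_sub_tendsto_zero]
      have hb : Tendsto (fun ε : ℝ => C * ε) (𝓝[>] 0) (𝓝 0) := by
        have : Tendsto (fun ε : ℝ => C * ε) (𝓝 0) (𝓝 (C * 0)) := tendsto_id.const_mul C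
        rw [mul_zero] at this
        exact this.mono_left nhdsWithin_le_nhds
      refine squeeze_zero' (Eventually.of_forall fun _ => norm_nonneg _) ?_ hb
      filter_upwards [nhdsWithin_le_nhds h', eventually_lt_one_nhdsGT] with ε h1 h2
      have hp : 0 < ε ^ n := pow_pos h2.1 n
      rw [Real.norm_eq_abs, div_sub' hp.ne', abs_div, abs_of_pos hp, div_le_iff₀ hp, mul_comm (ε ^ n)]
      rw [abs_of_pos h2.1, pow_succ] at h1
      linarith

/-- A shear of order `n` below the slope of the principal face
does not increase the Newton distance. -/
theorem newtonDistance_shear_le {g : ℝ × ℝ → ℝ} {ψ : ℝ → ℝ} (hg : SmoothNear g 0)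
    (hψ : SmoothNear ψ 0) (hψ0 : ψ 0 = 0) {n : ℕ} (hn : 1 ≤ n) {c B : ℝ} (hc : c ≠ 0)
    (hB : 0 ≤ B) (hψB : ∀ᶠ s in 𝓝 (0 : ℝ), |ψ s| ≤ B * |s| ^ n)
    (hlim : Tendsto (fun ε => ψ ε / ε ^ n) (𝓝[>] 0) (𝓝 c)) {κ : ℝ × ℝ} (hκ1 : 0 < κ.1)
    (hκn : n * κ.1 < κ.2) {d : ℝ} (hd : (d, d) ∈ newtonPolyhedron g)
    (hκd : κ.1 * d + κ.2 * d = 1)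
    (hκ : ∀ α ∈ taylorSupport g, 1 ≤ κ.1 * α.1 + κ.2 * α.2) :
    newtonDistance (shear g ψ) ≤ d := by
  have hn0 : (0 : ℝ) < n := by exact_mod_cast hn
  have hne : (taylorSupport g).Nonempty := by
    by_contra h
    rw [not_nonempty_iff_eq_empty] at h
    simp [newtonPolyhedron, h] at hd
  -- The relevant line is `t₁ + n t₂ = D`, supporting the polyhedron of `g`. Its edge polynomial `p`
  -- governs both `g` and the sheared function.
  obtain ⟨α₀, hα₀, hmin⟩ := exists_minimal_weight hne one_pos hn0
  set D : ℝ := 1 * α₀.1 + n * α₀.2 with hD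
  have hψB' : ∀ᶠ s in 𝓝 (0 : ℝ), |ψ s| ≤ B * |s| ^ ((n : ℝ) / 1) := by
    simpa [Real.rpow_natCast] using hψB
  have hmina := le_weight_shear hg hψ hψ0 one_pos hn0 hB hψB' hmin
  obtain ⟨p, hp1, hp2, hp3⟩ := hg.exists_edgePolynomial one_pos hn0 hmin
  obtain ⟨q, hq1, hq2, hq3⟩ := (hg.shear hψ hψ0).exists_edgePolynomial one_pos hn0 hmina
  have hp0 : p ≠ 0 := by
    intro h
    have := hp1 α₀ rfl
    rw [h, Polynomial.coeff_zero] at this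
    exact taylorCoeff_ne_zero.mpr hα₀ this.symm
  have hqp : q = p.taylor c := by
    refine Polynomial.funext fun y => ?_
    rw [Polynomial.taylor_eval]
    refine tendsto_nhds_unique (hq3 y (fun _ => y) tendsto_const_nhds) ?_
    -- The shear sends `(ε, ε^n y)` to `(ε, ε^n (y + ψ(ε)/ε^n))`, which is why
    -- `exists_edgePolynomial` lets the second variable depend on `ε`.
    refine (hp3 (y + c) (fun ε => y + ψ ε / ε ^ n) (tendsto_const_nhds.add hlim)).congr' ?_
    filter_upwards [eventually_lt_one_nhdsGT] with ε hε
    have : ε ^ n ≠ 0 := pow_ne_zero _ hε.1.ne'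
    simp only [shear, Real.rpow_one, Real.rpow_natCast]
    congr 3
    field_simp
  have hq0 : q ≠ 0 := by
    rw [hqp]
    exact fun h => hp0 ((Polynomial.taylor_eq_zero c p).mp h)
  set b := p.natTrailingDegree with hb
  set k := q.natTrailingDegree with hk
  set J := p.natDegree with hJ
  have hJq : q.natDegree = J := by rw [hqp, Polynomial.natDegree_taylor]
  -- `b` and `k` are the multiplicities of the distinct roots `0` and `c` of `p`.
  have hbk : b + k ≤ J := by
    have h1 : (Polynomial.X : Polynomial ℝ) ^ b ∣ p := by
      rw [Polynomial.X_pow_dvd_iff]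
      exact fun i hi => Polynomial.coeff_eq_zero_of_lt_natTrailingDegree hi
    have h2 : (Polynomial.X - Polynomial.C c) ^ k ∣ p := by
      have h3 : (Polynomial.X : Polynomial ℝ) ^ k ∣ q := by
        rw [Polynomial.X_pow_dvd_iff]
        exact fun i hi => Polynomial.coeff_eq_zero_of_lt_natTrailingDegree hi
      obtain ⟨s, hs⟩ := h3
      refine ⟨s.taylor (-c), ?_⟩
      have : p = q.taylor (-c) := by
        rw [hqp, Polynomial.taylor_taylor, neg_add_cancel, Polynomial.taylor_zero]
      rw [this, hs, Polynomial.taylor_mul, Polynomial.taylor_pow, Polynomial.taylor_X]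
      simp [sub_eq_add_neg]
    have hcop : IsCoprime ((Polynomial.X : Polynomial ℝ) ^ b) ((Polynomial.X - Polynomial.C c) ^ k) := by
      refine IsCoprime.pow ?_
      have := Polynomial.isCoprime_X_sub_C_of_isUnit_sub (R := ℝ) (a := 0) (b := c)
        (by simpa using hc)
      simpa using this
    have h4 := Polynomial.natDegree_le_of_dvd (hcop.mul_dvd h1 h2) hp0
    rwa [Polynomial.natDegree_mul (pow_ne_zero _ Polynomial.X_ne_zero)
      (pow_ne_zero _ (Polynomial.X_sub_C_ne_zero c)), Polynomial.natDegree_X_pow,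
      Polynomial.natDegree_pow, Polynomial.natDegree_X_sub_C, mul_one] at h4
  obtain ⟨β, hβ, hβb, hβD⟩ := hp2 b (by
    rw [hb, ← Polynomial.trailingCoeff]
    exact Polynomial.trailingCoeff_nonzero_iff_nonzero.mpr hp0)
  obtain ⟨γ, hγ, hγk, hγD⟩ := hq2 k (by
    rw [hk, ← Polynomial.trailingCoeff]
    exact Polynomial.trailingCoeff_nonzero_iff_nonzero.mpr hq0)
  obtain ⟨η, hη, hηJ, hηD⟩ := hq2 J (by
    rw [← hJq]
    exact Polynomial.leadingCoeff_ne_zero.mpr hq0)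
  have hDd : D ≤ 1 * d + n * d :=
    le_weight_of_mem_newtonPolyhedron (g := g) zero_le_one hn0.le hmin hd
  have h1n : (0 : ℝ) < 1 + n := by linarith
  have hed : D / (1 + n) ≤ d := by
    rw [div_le_iff₀ h1n]
    linarith
  -- The lowest point of the edge lies on or above height `d`: it satisfies `t₁ + n t₂ ≤ (1 + n) d`
  -- and lies above the steeper weight's line `L_κ` through `(d, d)`. Subtracting leaves `(κ₂ - n
  -- κ₁)(β₂ - d) ≥ 0`.
  have hbd : d ≤ β.2 := by
    have h1 := hκ β hβ
    have h2 : (β.1 : ℝ) - d ≤ -(n * (β.2 - d)) := by linarith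
    have h3 := mul_le_mul_of_nonneg_left h2 hκ1.le
    have h4 : 0 ≤ (κ.2 - n * κ.1) * (β.2 - d) := by linarith
    have := nonneg_of_mul_nonneg_right h4 (sub_pos.mpr hκn)
    linarith
  have heq : (1 + n : ℝ) * (D / (1 + n)) = D := mul_div_cancel₀ _ h1n.ne'
  set e := D / (1 + n) with he
  have hbJ : (b : ℝ) + k ≤ J := by exact_mod_cast hbk
  have hη1 : (0 : ℝ) ≤ η.1 := Nat.cast_nonneg _
  rw [hγk] at hγD
  rw [hηJ] at hηD
  rw [hβb] at hβD hbd
  -- Here `n k ≤ n J - n b ≤ D - n e = e`, using that the top endpoint has nonnegative first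
  -- coordinate. So the lowest point of the sheared edge is on or below the bisectrix, and its top
  -- point, at height `J ≥ b ≥ e`, is on or above it.
  have hnk : n * (k : ℝ) ≤ e := by
    have h1 : n * ((b : ℝ) + k) ≤ n * J := mul_le_mul_of_nonneg_left hbJ hn0.le
    have h2 : n * e ≤ n * (b : ℝ) := mul_le_mul_of_nonneg_left (hed.trans hbd) hn0.le
    linarith
  have hke : (k : ℝ) ≤ e := by
    have : (k : ℝ) ≤ n * k := le_mul_of_one_le_left (Nat.cast_nonneg _) (by exact_mod_cast hn)
    linarith
  refine (newtonDistance_le_of_segment hγ hη hn0 (D := D) ?_ ?_ ?_ ?_).trans hed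
  · rw [hγk]; linarith
  · rw [hηJ]; linarith
  · rw [hγk]; exact hke
  · rw [hηJ]
    have : (0 : ℝ) ≤ k := Nat.cast_nonneg _
    show e ≤ J
    linarith

/-! ### Test functions -/

/-- A smooth cutoff on the line, equal to one on `[-1, 1]` and supported in `[-2, 2]`. -/
noncomputable def cutoff : ContDiffBump (0 : ℝ) := ⟨1, 2, one_pos, one_lt_two⟩

theorem cutoff_eq_zero {t : ℝ} (ht : 2 ≤ |t|) : cutoff t = 0 :=
  cutoff.zero_of_le_dist (by simpa [cutoff] using ht)

/-- The product cutoff adapted to the box `|xᵢ| ≤ 1 / sᵢ`. -/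
noncomputable def boxBump (s : Fin 3 → ℝ) (x : EuclideanSpace ℝ (Fin 3)) : ℝ :=
  ∏ i, cutoff (s i * x i)

theorem boxBump_nonneg (s : Fin 3 → ℝ) (x : EuclideanSpace ℝ (Fin 3)) : 0 ≤ boxBump s x :=
  Finset.prod_nonneg fun _ _ => cutoff.nonneg

theorem boxBump_le_one (s : Fin 3 → ℝ) (x : EuclideanSpace ℝ (Fin 3)) : boxBump s x ≤ 1 :=
  Finset.prod_le_one (fun _ _ => cutoff.nonneg) fun _ _ => cutoff.le_one

theorem boxBump_eq_zero {s : Fin 3 → ℝ} (hs : ∀ i, 0 < s i) {x : EuclideanSpace ℝ (Fin 3)}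
    {i : Fin 3} (hi : 2 / s i ≤ |x i|) : boxBump s x = 0 := by
  refine Finset.prod_eq_zero (Finset.mem_univ i) (cutoff_eq_zero ?_)
  rw [abs_mul, abs_of_pos (hs i)]
  rwa [div_le_iff₀' (hs i)] at hi

theorem contDiff_boxBump (s : Fin 3 → ℝ) : ContDiff ℝ ∞ (boxBump s) := by
  unfold boxBump
  refine contDiff_prod fun i _ => cutoff.contDiff.comp ?_
  fun_prop

theorem hasCompactSupport_boxBump {s : Fin 3 → ℝ} (hs : ∀ i, 0 < s i) :
    HasCompactSupport (boxBump s) := by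
  refine HasCompactSupport.intro (isCompact_closedBall 0 √(∑ i, (2 / s i) ^ 2)) fun x hx => ?_
  by_contra h
  refine hx ?_
  rw [mem_closedBall_zero_iff, EuclideanSpace.norm_eq]
  refine Real.sqrt_le_sqrt (Finset.sum_le_sum fun i _ => ?_)
  have : |x i| ≤ 2 / s i := le_of_not_ge fun h' => h (boxBump_eq_zero hs h')
  gcongr
  exact this

theorem integral_boxBump {s : Fin 3 → ℝ} (hs : ∀ i, 0 < s i) :
    ∫ x, boxBump s x = (∫ t, cutoff t) ^ 3 / ∏ i, s i := by
  rw [← (PiLp.volume_preserving_toLp (Fin 3)).integral_comp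
    (MeasurableEquiv.toLp 2 (Fin 3 → ℝ)).measurableEmbedding]
  simp only [boxBump]
  rw [integral_fintype_prod_volume_eq_prod (fun i t => cutoff (s i * t))]
  simp_rw [Measure.integral_comp_mul_left (fun t => cutoff t), smul_eq_mul]
  rw [Finset.prod_mul_distrib, Finset.prod_const, Finset.card_univ, Fintype.card_fin]
  simp_rw [fun i => abs_of_pos (inv_pos.mpr (hs i))]
  rw [Finset.prod_inv_distrib]
  field_simp

/-- The bound `1/6` keeps the phase within `π/3`, where the cosine is at least `1/2`. -/
theorem half_integral_le_norm_fourier {V : Type*} [NormedAddCommGroup V] [InnerProductSpace ℝ V]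
    [MeasurableSpace V] [BorelSpace V] [FiniteDimensional ℝ V] {f : V → ℝ} (hf : Integrable f)
    (hf0 : ∀ x, 0 ≤ f x) {ξ : V} (h : ∀ x, f x ≠ 0 → |inner ℝ x ξ| ≤ 1 / 6) :
    1 / 2 * ∫ x, f x ≤ ‖𝓕 (fun x => (f x : ℂ)) ξ‖ := by
  refine le_trans ?_ (Complex.re_le_norm _)
  rw [Real.fourier_eq']
  have hint : Integrable fun x =>
      Complex.exp (↑(-2 * Real.pi * inner ℝ x ξ) * Complex.I) • (f x : ℂ) := by
    refine hf.ofReal.bdd_mul (c := 1) ?_ ?_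
    · exact (by fun_prop : Continuous fun x : V =>
        Complex.exp (↑(-2 * Real.pi * inner ℝ x ξ) * Complex.I)).aestronglyMeasurable
    · exact Eventually.of_forall fun x => (Complex.norm_exp_ofReal_mul_I _).le
  have hre := integral_re hint
  simp only [RCLike.re_to_complex] at hre
  rw [← hre, ← integral_const_mul]
  refine integral_mono (hf.const_mul _) hint.re fun x => ?_
  have hval : (Complex.exp (↑(-2 * Real.pi * inner ℝ x ξ) * Complex.I) • (f x : ℂ)).re =
      Real.cos (-2 * Real.pi * inner ℝ x ξ) * f x := by
    rw [smul_eq_mul, Complex.re_mul_ofReal, Complex.exp_ofReal_mul_I_re]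
  show 1 / 2 * f x ≤ (Complex.exp (↑(-2 * Real.pi * inner ℝ x ξ) * Complex.I) • (f x : ℂ)).re
  rw [hval]
  by_cases hx : f x = 0
  · simp [hx]
  refine mul_le_mul_of_nonneg_right ?_ (hf0 x)
  rw [← Real.cos_abs, ← Real.cos_pi_div_three]
  refine Real.cos_le_cos_of_nonneg_of_le_pi (abs_nonneg _) (by linarith [Real.pi_pos]) ?_
  rw [abs_mul, abs_mul, abs_neg, abs_two, abs_of_pos Real.pi_pos]
  nlinarith [h x hx, Real.pi_pos]

theorem le_norm_fourier_boxBump {s : Fin 3 → ℝ} (hs : ∀ i, 0 < s i)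
    {ξ : EuclideanSpace ℝ (Fin 3)} (hξ : ∀ i, |ξ i| ≤ s i / 36) :
    1 / 2 * ((∫ t, cutoff t) ^ 3 / ∏ i, s i) ≤ ‖𝓕 (fun x => (boxBump s x : ℂ)) ξ‖ := by
  rw [← integral_boxBump hs]
  refine half_integral_le_norm_fourier
    ((contDiff_boxBump s).continuous.integrable_of_hasCompactSupport (hasCompactSupport_boxBump hs))
    (boxBump_nonneg s) fun x hx => ?_
  rw [PiLp.inner_apply]
  refine (Finset.abs_sum_le_sum_abs _ _).trans ?_
  -- The bump lives in `|xᵢ| ≤ 2 / sᵢ`, so the factor `36` makes the three terms add up to `1/6`.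
  have (i : Fin 3) : |inner ℝ (x i) (ξ i)| ≤ 1 / 18 := by
    have h1 : |x i| ≤ 2 / s i := le_of_not_ge fun h' => hx (boxBump_eq_zero hs h')
    have h2 : |inner ℝ (x i) (ξ i)| = |x i| * |ξ i| := by
      rw [← abs_mul]
      simp [mul_comm]
    rw [h2]
    calc |x i| * |ξ i| ≤ 2 / s i * (s i / 36) :=
          mul_le_mul h1 (hξ i) (abs_nonneg _) (div_pos two_pos (hs i)).le
      _ = 1 / 18 := by
        have := (hs i).ne'
        field_simp
        norm_num
  calc _ ≤ ∑ _i : Fin 3, (1 / 18 : ℝ) := Finset.sum_le_sum fun i _ => this i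
    _ = 1 / 6 := by simp; norm_num

/-- For an infinite exponent `1 / toReal` is `0`, and the corresponding factor is `1`, as it should
be for a supremum. -/
theorem mixedNorm_boxBump_le {s : Fin 3 → ℝ} (hs : ∀ i, 0 < s i) (p₁ p₃ : ℝ≥0∞) :
    mixedNorm p₁ p₃ (fun x => (boxBump s x : ℂ)) ≤
      ENNReal.ofReal (4 / s 0 * (4 / s 1)) ^ (1 / p₁.toReal) *
        ENNReal.ofReal (4 / s 2) ^ (1 / p₃.toReal) := by
  set Q : Set (ℝ × ℝ) := Icc (-(2 / s 0)) (2 / s 0) ×ˢ Icc (-(2 / s 1)) (2 / s 1) with hQ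
  set T : Set ℝ := Icc (-(2 / s 2)) (2 / s 2) with hT
  have hQv : volume Q = ENNReal.ofReal (4 / s 0 * (4 / s 1)) := by
    rw [hQ, Measure.volume_eq_prod, Measure.prod_prod, Real.volume_Icc, Real.volume_Icc,
      ← ENNReal.ofReal_mul (by have := (hs 0).le; rw [sub_neg_eq_add]; positivity)]
    congr 1
    ring
  have hTv : volume T = ENNReal.ofReal (4 / s 2) := by
    rw [hT, Real.volume_Icc]
    congr 1
    ring
  set N := ENNReal.ofReal (4 / s 0 * (4 / s 1)) ^ (1 / p₁.toReal) with hN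
  have hinner (t : ℝ) : eLpNorm (fun x : ℝ × ℝ => (boxBump s (pt x t) : ℂ)) p₁ volume ≤
      T.indicator (fun _ => N) t := by
    by_cases ht : t ∈ T
    · rw [indicator_of_mem ht]
      have h1 : eLpNorm (fun x : ℝ × ℝ => (boxBump s (pt x t) : ℂ)) p₁ volume ≤
          eLpNorm (Q.indicator fun _ => (1 : ℝ)) p₁ volume := by
        refine eLpNorm_mono fun x => ?_
        by_cases hx : x ∈ Q
        · rw [indicator_of_mem hx, Complex.norm_real, Real.norm_of_nonneg (boxBump_nonneg _ _)]
          simpa using boxBump_le_one s _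
        · have : boxBump s (pt x t) = 0 := by
            by_contra h
            refine hx ⟨?_, ?_⟩
            · exact abs_le.mp (le_of_not_ge fun h' => h (boxBump_eq_zero hs (i := 0) h'))
            · exact abs_le.mp (le_of_not_ge fun h' => h (boxBump_eq_zero hs (i := 1) h'))
          simp [this]
      refine h1.trans ((eLpNorm_indicator_const_le _ _).trans ?_)
      rw [hQv]
      simp [hN]
    · have (x : ℝ × ℝ) : boxBump s (pt x t) = 0 := by
        by_contra h
        exact ht (abs_le.mp (le_of_not_ge fun h' => h (boxBump_eq_zero hs (i := 2) h')))
      simp [this]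
  refine (eLpNorm_mono_enorm (g := T.indicator fun _ => N) fun t => ?_).trans
    ((eLpNorm_indicator_const_le _ _).trans ?_)
  · simpa using hinner t
  · rw [hTv]
    simp

/-! ### The Knapp condition -/

theorem exponent_le_of_rpow_le {K₁ K₂ X Y : ℝ} (hK : 0 < K₁)
    (h : ∀ᶠ ε in 𝓝[>] (0 : ℝ), K₁ * ε ^ X ≤ K₂ * ε ^ Y) : Y ≤ X := by
  by_contra! hlt
  have hlim : Tendsto (fun ε : ℝ => K₂ * ε ^ (Y - X)) (𝓝[>] 0) (𝓝 0) := by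
    simpa using (tendsto_rpow_nhdsGT_zero (sub_pos.mpr hlt)).const_mul K₂
  refine absurd (ge_of_tendsto hlim ?_) (not_le.mpr hK)
  filter_upwards [h, eventually_lt_one_nhdsGT] with ε h1 h2
  have hX := Real.rpow_pos_of_pos h2.1 X
  rw [Real.rpow_sub h2.1, ← mul_div_assoc, le_div_iff₀ hX]
  exact h1

theorem one_le_surfaceDensity (φ : ℝ × ℝ → ℝ) (x : ℝ × ℝ) : 1 ≤ surfaceDensity φ x := by
  rw [surfaceDensity, Real.one_le_sqrt]
  nlinarith [sq_nonneg (fderiv ℝ φ x (1, 0)), sq_nonneg (fderiv ℝ φ x (0, 1))]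

theorem toReal_inv_add_toReal_inv {p q : ℝ≥0∞} (h : ENNReal.HolderConjugate p q) :
    1 / p.toReal + (q⁻¹).toReal = 1 := by
  have h1 := ENNReal.HolderConjugate.inv_add_inv_eq_one p q
  have hp : p⁻¹ ≠ ⊤ := ne_top_of_le_ne_top ENNReal.one_ne_top (h1 ▸ le_self_add)
  have hq : q⁻¹ ≠ ⊤ := ne_top_of_le_ne_top ENNReal.one_ne_top (h1 ▸ le_add_self)
  rw [one_div, ← ENNReal.toReal_inv, ← ENNReal.toReal_add hp hq, h1, ENNReal.toReal_one]

/-- Testing the restriction estimate on a box: if the part of the surface lying in the box projects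
onto a set `D` with `ρ ≥ c₀` there, then the estimate bounds the size of `D`. -/
theorem RestrictionEstimate.box_test {Ω : Set (ℝ × ℝ)} {φ ρ : ℝ × ℝ → ℝ} {p₁ p₃ : ℝ≥0∞} {C : ℝ≥0}
    (hC : ∀ f : 𝓢(EuclideanSpace ℝ (Fin 3), ℂ),
      (surfaceIntegralSq Ω φ ρ (𝓕 (f : EuclideanSpace ℝ (Fin 3) → ℂ))) ^ (1 / 2 : ℝ)
        ≤ C * mixedNorm p₁ p₃ f) {c₀ : ℝ} (hc₀ : 0 ≤ c₀) {s : Fin 3 → ℝ} (hs : ∀ i, 0 < s i)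
    {D : Set (ℝ × ℝ)} (hD : MeasurableSet D) (hDΩ : D ⊆ Ω) {V : ℝ} (hV : 0 ≤ V)
    (hvol : ENNReal.ofReal V ≤ volume D) (hDρ : ∀ x ∈ D, c₀ ≤ ρ x)
    (hbox : ∀ x ∈ D, ∀ i, |pt x (φ x) i| ≤ s i / 36) :
    1 / 2 * ((∫ t, cutoff t) ^ 3 / ∏ i, s i) * (c₀ * V) ^ (1 / 2 : ℝ) ≤
      C * ((4 / s 0 * (4 / s 1)) ^ (1 / p₁.toReal) * (4 / s 2) ^ (1 / p₃.toReal)) := by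
  have hcs : HasCompactSupport fun x => (boxBump s x : ℂ) :=
    (hasCompactSupport_boxBump hs).comp_left Complex.ofReal_zero
  have hcd : ContDiff ℝ ∞ fun x => (boxBump s x : ℂ) :=
    Complex.ofRealCLM.contDiff.comp (contDiff_boxBump s)
  have hest := hC (hcs.toSchwartzMap hcd)
  have hcoe : ((hcs.toSchwartzMap hcd : 𝓢(EuclideanSpace ℝ (Fin 3), ℂ)) :
      EuclideanSpace ℝ (Fin 3) → ℂ) = fun x => (boxBump s x : ℂ) := rfl
  rw [hcoe] at hest
  set H := 1 / 2 * ((∫ t, cutoff t) ^ 3 / ∏ i, s i) with hH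
  have hprod : 0 < ∏ i, s i := Finset.prod_pos fun i _ => hs i
  have hH0 : 0 ≤ H := by
    have : 0 < ∫ t, cutoff t := cutoff.integral_pos
    positivity
  have hlow : ENNReal.ofReal (H ^ 2 * (c₀ * V)) ≤
      surfaceIntegralSq Ω φ ρ (𝓕 fun x => (boxBump s x : ℂ)) := by
    calc ENNReal.ofReal (H ^ 2 * (c₀ * V))
        = ENNReal.ofReal (H ^ 2 * c₀) * ENNReal.ofReal V := by
          rw [← ENNReal.ofReal_mul (by positivity), mul_assoc]
      _ ≤ ENNReal.ofReal (H ^ 2 * c₀) * volume D := by gcongr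
      _ = ∫⁻ _ in D, ENNReal.ofReal (H ^ 2 * c₀) := by rw [setLIntegral_const]
      _ ≤ ∫⁻ x in D, ‖𝓕 (fun x => (boxBump s x : ℂ)) (pt x (φ x))‖ₑ ^ 2 *
            ENNReal.ofReal (ρ x * surfaceDensity φ x) := by
          refine setLIntegral_mono' hD fun x hx => ?_
          rw [ENNReal.ofReal_mul (by positivity), ENNReal.ofReal_pow hH0]
          gcongr
          · rw [← ofReal_norm]
            exact ENNReal.ofReal_le_ofReal (le_norm_fourier_boxBump hs (hbox x hx))
          · have h1 := hDρ x hx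
            exact h1.trans (le_mul_of_one_le_right (hc₀.trans h1) (one_le_surfaceDensity φ x))
      _ ≤ _ := lintegral_mono_set hDΩ
  have hs0 := hs 0
  have hs1 := hs 1
  have hs2 := hs 2
  have hfin : ENNReal.ofReal (H * (c₀ * V) ^ (1 / 2 : ℝ)) ≤
      ENNReal.ofReal
        (C * ((4 / s 0 * (4 / s 1)) ^ (1 / p₁.toReal) * (4 / s 2) ^ (1 / p₃.toReal))) := by
    calc ENNReal.ofReal (H * (c₀ * V) ^ (1 / 2 : ℝ))
        = ENNReal.ofReal (H ^ 2 * (c₀ * V)) ^ (1 / 2 : ℝ) := by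
          rw [ENNReal.ofReal_rpow_of_nonneg (by positivity) (by norm_num),
            Real.mul_rpow (x := H ^ 2) (by positivity) (by positivity), ← Real.sqrt_eq_rpow (H ^ 2),
            Real.sqrt_sq hH0]
      _ ≤ _ := ENNReal.rpow_le_rpow hlow (by norm_num)
      _ ≤ _ := hest
      _ ≤ _ := mul_le_mul_right (mixedNorm_boxBump_le hs p₁ p₃) _
      _ = _ := by
          rw [ENNReal.ofReal_rpow_of_pos (by positivity), ENNReal.ofReal_rpow_of_pos (by positivity),
            ENNReal.ofReal_mul (by positivity), ENNReal.ofReal_mul (by positivity),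
            ENNReal.ofReal_coe_nnreal]
  exact (ENNReal.ofReal_le_ofReal_iff (by positivity)).mp hfin

theorem volume_shearedBox {ψ : ℝ → ℝ} (hψ : Measurable ψ) {a b : ℝ} (hb : 0 ≤ b) :
    volume (regionBetween (fun s => ψ s - b) (fun s => ψ s + b) (Ioo (-a) a)) =
      ENNReal.ofReal (4 * (a * b)) := by
  rw [Measure.volume_eq_prod, volume_regionBetween_eq_lintegral' (hψ.sub_const b) (hψ.add_const b)
    measurableSet_Ioo]
  have (s : ℝ) : ((fun s => ψ s + b) - fun s => ψ s - b) s = 2 * b := by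
    simp only [Pi.sub_apply]
    ring
  simp_rw [this]
  rw [setLIntegral_const, Real.volume_Ioo, ← ENNReal.ofReal_mul (by positivity)]
  congr 1
  ring

/-- The necessary condition obtained by testing the restriction estimate on the boxes
`|x₁| ≲ ε^u`, `|x₂| ≲ ε^μ`, `|x₃| ≲ ε`, which contain the part of the surface over
`|x₁| < ε^u`, `|x₂ - ψ(x₁)| < ε^v`. -/
theorem knapp_condition {Ω : Set (ℝ × ℝ)} (hΩ : IsOpen Ω) (h0 : (0 : ℝ × ℝ) ∈ Ω)
    {φ ρ : ℝ × ℝ → ℝ} (hφ : SmoothNear φ 0) (hρ : Continuous ρ) (hρ0 : 0 < ρ 0)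
    {p₁ p₃ p₁' p₃' : ℝ≥0∞} (hp₁ : ENNReal.HolderConjugate p₁ p₁')
    (hp₃ : ENNReal.HolderConjugate p₃ p₃') (hest : RestrictionEstimate Ω φ ρ p₁ p₃)
    {ψ : ℝ → ℝ} (hψ : SmoothNear ψ 0) (hψ0 : ψ 0 = 0) {u v μ B : ℝ} (hu : 0 < u) (hv : 0 < v)
    (hμ : 0 < μ) (hμv : μ ≤ v) (hB : 0 ≤ B)
    (hψB : ∀ᶠ s in 𝓝 (0 : ℝ), |ψ s| ≤ B * |s| ^ (μ / u))
    (hs : ∀ α ∈ taylorSupport (shear φ ψ), 1 ≤ u * α.1 + v * α.2) :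
    (p₃'⁻¹).toReal + (u + μ) * (p₁'⁻¹).toReal ≤ (u + v) / 2 := by
  classical
  obtain ⟨C, hC⟩ := hest
  obtain ⟨A₀, hA₀, hgrowth⟩ := (hφ.shear hψ hψ0).growth hu hv hs (A := 1) zero_le_one
  obtain ⟨δ, hδ, hψball⟩ := Metric.eventually_nhds_iff_ball.mp (hψ.and hψB)
  have hcont : ContinuousOn ψ (Metric.ball 0 δ) := fun s hs =>
    (hψball s hs).1.continuousAt.continuousWithinAt
  -- Smoothness of `ψ` is known only near `0`; this modification is globally measurable and agrees
  -- with `ψ` over the small boxes.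
  set ψ' := (Metric.ball (0 : ℝ) δ).piecewise ψ 0 with hψ'
  have hψ'm : Measurable ψ' :=
    hcont.measurable_piecewise continuousOn_const measurableSet_ball
  have hnear : ∀ᶠ x in 𝓝 (0 : ℝ × ℝ), x ∈ Ω ∧ ρ 0 / 2 ≤ ρ x :=
    (show ∀ᶠ x in 𝓝 (0 : ℝ × ℝ), x ∈ Ω from hΩ.mem_nhds h0).and (hρ.continuousAt.eventually (eventually_ge_nhds (half_lt_self hρ0)))
  obtain ⟨δ', hδ', hball⟩ := Metric.eventually_nhds_iff_ball.mp hnear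
  -- `36` comes from the dual box; `1`, `1 + B` and `A₀` are the constants bounding `x₁`, `x₂` and
  -- `φ` on the region.
  set Λ := 36 * (1 + B + A₀) with hΛ
  have hΛ0 : 0 < Λ := by positivity
  set I := ∫ t, cutoff t with hI
  have hI0 : 0 < I := cutoff.integral_pos
  set a := 1 / p₁.toReal with ha
  set b := 1 / p₃.toReal with hb
  -- Powers of `ε` in the box test: the right side comes from `∏ 1 / sᵢ` and the square root of the
  -- area `ε^(u+v)`, the left side from the mixed norm.
  have key : -(u + μ) * a - b ≤ -(u + μ + 1) + (u + v) / 2 := by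
    refine exponent_le_of_rpow_le (K₁ := 1 / 2 * (I ^ 3 / Λ ^ 3) * (2 * ρ 0) ^ (1 / 2 : ℝ))
      (K₂ := C * ((16 / Λ ^ 2) ^ a * (4 / Λ) ^ b)) (by positivity) ?_
    have hlim (e : ℝ) (he : 0 < e) : ∀ᶠ ε in 𝓝[>] (0 : ℝ), (1 + B) * ε ^ e < δ' := by
      have := (tendsto_rpow_nhdsGT_zero he).const_mul (1 + B)
      rw [mul_zero] at this
      exact this.eventually (gt_mem_nhds hδ')
    filter_upwards [hgrowth, eventually_lt_one_nhdsGT, hlim u hu, hlim μ hμ,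
      (tendsto_rpow_nhdsGT_zero hu).eventually (gt_mem_nhds hδ)] with ε hg hε hεu' hεμ' hεδ
    obtain ⟨hε0, hε1⟩ := hε
    have hεu := Real.rpow_pos_of_pos hε0 u
    have hεv := Real.rpow_pos_of_pos hε0 v
    have hεμ := Real.rpow_pos_of_pos hε0 μ
    have hvμ : ε ^ v ≤ ε ^ μ := Real.rpow_le_rpow_of_exponent_ge hε0 hε1.le hμv
    set D := regionBetween (fun s => ψ' s - ε ^ v) (fun s => ψ' s + ε ^ v) (Ioo (-ε ^ u) (ε ^ u))
      with hD
    have hmem (x : ℝ × ℝ) (hx : x ∈ D) :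
        |x.1| ≤ ε ^ u ∧ |x.2| ≤ (1 + B) * ε ^ μ ∧ |φ x| ≤ A₀ * ε := by
      obtain ⟨hx1, hx2, hx3⟩ := hx
      have h1 : |x.1| < ε ^ u := abs_lt.mpr hx1
      have hxδ : x.1 ∈ Metric.ball (0 : ℝ) δ := by
        rw [mem_ball_zero_iff]
        exact h1.trans hεδ
      have heq : ψ' x.1 = ψ x.1 := by rw [hψ', piecewise_eq_of_mem _ _ _ hxδ]
      simp only [heq] at hx2 hx3
      have h2 : |x.2 - ψ x.1| ≤ ε ^ v := abs_le.mpr ⟨by linarith, by linarith⟩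
      have h3 : |ψ x.1| ≤ B * ε ^ μ := by
        refine (hψball x.1 hxδ).2.trans (mul_le_mul_of_nonneg_left ?_ hB)
        have := Real.rpow_le_rpow (abs_nonneg _) h1.le (div_pos hμ hu).le
        rwa [← Real.rpow_mul hε0.le, mul_div_cancel₀ _ hu.ne'] at this
      refine ⟨h1.le, ?_, ?_⟩
      · have : |x.2| ≤ |x.2 - ψ x.1| + |ψ x.1| := by
          simpa using abs_add_le (x.2 - ψ x.1) (ψ x.1)
        linarith
      · have := hg (x.1, x.2 - ψ x.1) (by simpa using h1.le) (by simpa using h2)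
        simpa [shear] using this
    have hD' (x : ℝ × ℝ) (hx : x ∈ D) : x ∈ Ω ∧ ρ 0 / 2 ≤ ρ x := by
      refine hball x ?_
      obtain ⟨h1, h2, -⟩ := hmem x hx
      rw [mem_ball_zero_iff, Prod.norm_def, max_lt_iff]
      refine ⟨h1.trans_lt (lt_of_le_of_lt ?_ hεu'), h2.trans_lt hεμ'⟩
      exact le_mul_of_one_le_left hεu.le (by linarith)
    have hsp : ∀ i, 0 < (![Λ * ε ^ u, Λ * ε ^ μ, Λ * ε] : Fin 3 → ℝ) i := by
      intro i
      fin_cases i <;> simp <;> positivity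
    have htest := RestrictionEstimate.box_test hC (half_pos hρ0).le hsp
      (measurableSet_regionBetween (hψ'm.sub_const _) (hψ'm.add_const _) measurableSet_Ioo)
      (fun x hx => (hD' x hx).1) (V := 4 * (ε ^ u * ε ^ v)) (by positivity)
      (volume_shearedBox hψ'm hεv.le).ge (fun x hx => (hD' x hx).2) (by
        intro x hx i
        obtain ⟨h1, h2, h3⟩ := hmem x hx
        fin_cases i
        · simp only [pt, hΛ, Fin.zero_eta, Fin.isValue, PiLp.toLp_apply, Matrix.cons_val_zero]
          nlinarith
        · simp only [pt, hΛ, Fin.mk_one, Fin.isValue, PiLp.toLp_apply, Matrix.cons_val_one,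
            Matrix.cons_val_zero]
          nlinarith
        · simp only [pt, hΛ, Fin.reduceFinMk, Fin.isValue, PiLp.toLp_apply, Matrix.cons_val]
          nlinarith)
    simp only [Fin.prod_univ_three, Fin.isValue, Matrix.cons_val_zero, Matrix.cons_val_one,
      Matrix.cons_val] at htest
    have hL : 1 / 2 * (I ^ 3 / Λ ^ 3) * (2 * ρ 0) ^ (1 / 2 : ℝ) * ε ^ (-(u + μ + 1) + (u + v) / 2) =
        1 / 2 * (I ^ 3 / (Λ * ε ^ u * (Λ * ε ^ μ) * (Λ * ε))) *
          (ρ 0 / 2 * (4 * (ε ^ u * ε ^ v))) ^ (1 / 2 : ℝ) := by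
      have e1 : ρ 0 / 2 * (4 * (ε ^ u * ε ^ v)) = 2 * ρ 0 * ε ^ (u + v) := by
        rw [Real.rpow_add hε0]; ring
      rw [e1, Real.mul_rpow (x := 2 * ρ 0) (by positivity) (by positivity), ← Real.rpow_mul hε0.le,
        mul_one_div (u + v), Real.rpow_add hε0, Real.rpow_neg hε0.le, Real.rpow_add hε0, Real.rpow_add hε0,
        Real.rpow_one]
      field_simp
    have hR : C * ((16 / Λ ^ 2) ^ a * (4 / Λ) ^ b) * ε ^ (-(u + μ) * a - b) =
        C * ((4 / (Λ * ε ^ u) * (4 / (Λ * ε ^ μ))) ^ a * (4 / (Λ * ε)) ^ b) := by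
      have e1 : 4 / (Λ * ε ^ u) * (4 / (Λ * ε ^ μ)) = 16 / Λ ^ 2 * ε ^ (-(u + μ)) := by
        rw [Real.rpow_neg hε0.le, Real.rpow_add hε0]
        field_simp
        norm_num
      have e2 : 4 / (Λ * ε) = 4 / Λ * ε ^ (-1 : ℝ) := by
        rw [Real.rpow_neg_one]
        field_simp
      rw [e1, e2, Real.mul_rpow (by positivity) (by positivity),
        Real.mul_rpow (by positivity) (by positivity), ← Real.rpow_mul hε0.le,
        ← Real.rpow_mul hε0.le, sub_eq_add_neg, Real.rpow_add hε0, neg_one_mul]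
      ring
    rw [hL, hR]
    exact htest
  have h1 := toReal_inv_add_toReal_inv hp₁
  have h3 := toReal_inv_add_toReal_inv hp₃
  rw [← ha] at h1
  rw [← hb] at h3
  have e1 : (p₁'⁻¹).toReal = 1 - a := by linarith
  have e3 : (p₃'⁻¹).toReal = 1 - b := by linarith
  rw [e1, e3]
  linarith

/-! ### Supporting weights -/

theorem add_mem_newtonPolyhedron {g : ℝ × ℝ → ℝ} {t w : ℝ × ℝ} (ht : t ∈ newtonPolyhedron g)
    (hw1 : 0 ≤ w.1) (hw2 : 0 ≤ w.2) : t + w ∈ newtonPolyhedron g := by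
  have hconv : Convex ℝ ((fun z => z + w) ⁻¹' newtonPolyhedron g) :=
    (convex_convexHull ℝ _).translate_preimage_left w
  refine convexHull_min (fun s hs => ?_) hconv ht
  refine subset_convexHull ℝ _ ?_
  simp only [mem_iUnion, mem_ofPred_eq] at hs ⊢
  obtain ⟨α, hα, h1, h2⟩ := hs
  exact ⟨α, hα, by simpa using by linarith, by simpa using by linarith⟩

theorem diag_mem_of_le {g : ℝ × ℝ → ℝ} {t : ℝ × ℝ} (ht : t ∈ newtonPolyhedron g) {e : ℝ}
    (h1 : t.1 ≤ e) (h2 : t.2 ≤ e) : (e, e) ∈ newtonPolyhedron g := by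
  have := add_mem_newtonPolyhedron ht (w := (e - t.1, e - t.2)) (by simpa) (by simpa)
  convert this using 1
  ext <;> simp

theorem two_le_order {φ : ℝ × ℝ → ℝ} (hφ0 : φ 0 = 0) (hdφ : fderiv ℝ φ 0 = 0) {α : ℕ × ℕ}
    (hα : α ∈ taylorSupport φ) : 2 ≤ α.1 + α.2 := by
  by_contra! h
  refine hα ?_
  obtain ⟨a, b⟩ := α
  rcases (by omega : a + b = 0 ∨ a + b = 1) with h' | h'
  · rw [partialAtZero_of_add_eq φ h', iteratedFDeriv_zero_apply, hφ0]
  · rw [partialAtZero_of_add_eq φ h', iteratedFDeriv_one_apply, hdφ]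
    rfl

theorem newtonDistance_pos {φ : ℝ × ℝ → ℝ} (hφ0 : φ 0 = 0) (hdφ : fderiv ℝ φ 0 = 0)
    (hfin : (taylorSupport φ).Nonempty) : 0 < newtonDistance φ := by
  obtain ⟨α, hα⟩ := hfin
  refine lt_of_lt_of_le one_pos (le_csInf ⟨max α.1 α.2, ?_⟩ fun t ht => ?_)
  · exact diag_mem_of_le (mem_newtonPolyhedron hα) (le_max_left _ _) (le_max_right _ _)
  · have := le_weight_of_mem_newtonPolyhedron (g := φ) (u := 1) (v := 1) (r := 2) zero_le_one
      zero_le_one (fun β hβ => by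
        have := two_le_order hφ0 hdφ hβ
        simpa using (by exact_mod_cast this : (2 : ℝ) ≤ β.1 + β.2)) ht
    simp only [one_mul] at this
    linarith

/-- There is a line through `(d, d)` with nonnegative weights that supports the Newton
polyhedron. -/
theorem exists_weight_at_diag {g : ℝ × ℝ → ℝ} (hne : (taylorSupport g).Nonempty)
    (hd : 0 < newtonDistance g) :
    ∃ a b : ℝ, 0 ≤ a ∧ 0 ≤ b ∧ (a + b) * newtonDistance g = 1 ∧
      ∀ t ∈ newtonPolyhedron g, 1 ≤ a * t.1 + b * t.2 := by
  set d := newtonDistance g with hd'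
  -- Minimality of `d` lets Hahn–Banach separate the open quadrant below `(d, d)` from the
  -- polyhedron.
  have hdisj : Disjoint (Iio d ×ˢ Iio d) (newtonPolyhedron g) := by
    refine Set.disjoint_left.mpr fun t ht htN => ?_
    have h1 := diag_mem_of_le htN (le_max_left t.1 t.2) (le_max_right t.1 t.2)
    exact absurd (csInf_le (bddBelow_diag g) h1) (not_le.mpr (max_lt ht.1 ht.2))
  obtain ⟨f, c, hf1, hf2⟩ := geometric_hahn_banach_open
    ((convex_Iio d).prod (convex_Iio d)) (isOpen_Iio.prod isOpen_Iio) (convex_convexHull ℝ _) hdisj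
  set a := f (1, 0) with ha
  set b := f (0, 1) with hb
  have hfab (t : ℝ × ℝ) : f t = a * t.1 + b * t.2 := by
    have : t = t.1 • ((1, 0) : ℝ × ℝ) + t.2 • ((0, 1) : ℝ × ℝ) := by ext <;> simp
    conv_lhs => rw [this, map_add, map_smul, map_smul]
    simp [ha, hb, mul_comm]
  obtain ⟨α, hα⟩ := hne
  have hαN := mem_newtonPolyhedron hα
  -- The polyhedron is stable under positive translations. If `f` decreased in such a direction,
  -- moving by `τ` would reach the value `c - 1`.
  have hup (x y : ℝ) (hx : 0 ≤ x) (hy : 0 ≤ y) : 0 ≤ a * x + b * y := by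
    by_contra! hneg
    set s := f ((α.1 : ℝ), (α.2 : ℝ)) with hs
    have hcs : c ≤ s := hf2 _ hαN
    set τ := (s - c + 1) / -(a * x + b * y) with hτ
    have hτ0 : 0 ≤ τ := div_nonneg (by linarith) (by linarith)
    have h1 := hf2 _ (add_mem_newtonPolyhedron hαN (w := (τ * x, τ * y)) (mul_nonneg hτ0 hx)
      (mul_nonneg hτ0 hy))
    rw [map_add, hfab (τ * x, τ * y)] at h1
    have h2 : τ * -(a * x + b * y) = s - c + 1 := div_mul_cancel₀ _ (by linarith)
    have h3 : a * (τ * x) + b * (τ * y) = -(τ * -(a * x + b * y)) := by ring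
    simp only at h1
    rw [h3, h2] at h1
    linarith
  have ha0 : 0 ≤ a := by simpa using hup 1 0 zero_le_one le_rfl
  have hb0 : 0 ≤ b := by simpa using hup 0 1 le_rfl zero_le_one
  have hcd : (a + b) * d ≤ c := by
    have hlim : Tendsto (fun e : ℝ => (a + b) * e) (𝓝[<] d) (𝓝 ((a + b) * d)) :=
      ((continuous_const.mul continuous_id).tendsto d).mono_left nhdsWithin_le_nhds
    refine le_of_tendsto hlim ?_
    filter_upwards [self_mem_nhdsWithin] with e he
    have := hf1 (e, e) ⟨he, he⟩
    rw [hfab] at this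
    simp only at this
    linarith
  have hab : 0 < a + b := by
    rcases (add_nonneg ha0 hb0).eq_or_lt with h | h
    · have h1 : a = 0 := by linarith
      have h2 : b = 0 := by linarith
      have h3 := hf1 (d - 1, d - 1) ⟨by simp, by simp⟩
      have h4 := hf2 _ hαN
      rw [hfab, h1, h2] at h3 h4
      linarith
    · exact h
  have hpos : 0 < (a + b) * d := mul_pos hab hd
  refine ⟨a / ((a + b) * d), b / ((a + b) * d), by positivity, by positivity, ?_, fun t ht => ?_⟩
  · field_simp
  · have h1 := hf2 t ht
    rw [hfab] at h1
    rw [div_mul_eq_mul_div, div_mul_eq_mul_div, ← add_div, one_le_div hpos]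
    linarith

/-- Used to remove the perturbation that makes degenerate weights strictly positive. -/
theorem le_of_forall_pos_le_add_mul {X Y Z : ℝ} (h : ∀ δ > 0, X ≤ Y + δ * Z) : X ≤ Y := by
  have hlim : Tendsto (fun δ : ℝ => Y + δ * Z) (𝓝[>] 0) (𝓝 (Y + 0 * Z)) :=
    ((by fun_prop : Continuous fun δ : ℝ => Y + δ * Z).tendsto 0).mono_left nhdsWithin_le_nhds
  rw [zero_mul, add_zero] at hlim
  exact ge_of_tendsto hlim (by filter_upwards [self_mem_nhdsWithin] with δ hδ using h δ hδ)

/-! ### Adapted shears -/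

theorem newtonDistance_lt_of_isAdaptedShear {φ : ℝ × ℝ → ℝ} {ψ : ℝ → ℝ} (hφ : ¬ IsAdapted φ)
    (hψ : IsAdaptedShear φ ψ) : newtonDistance φ < newtonDistance (shear φ ψ) := by
  have hid : IsLocalCoordinateChange id := by
    refine ⟨Eventually.of_forall fun x => contDiffAt_id, rfl, ?_⟩
    rw [fderiv_id]
    exact ContinuousLinearMap.isInvertible_equiv (f := ContinuousLinearEquiv.refl ℝ (ℝ × ℝ))
  have hle : (newtonDistance φ : EReal) ≤ height φ :=
    le_iSup₂_of_le (f := fun (Φ : ℝ × ℝ → ℝ × ℝ) (_ : IsLocalCoordinateChange Φ) =>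
      (newtonDistance (φ ∘ Φ) : EReal)) id hid le_rfl
  have hlt := lt_of_le_of_ne hle hφ
  rw [← hψ.2.2] at hlt
  exact_mod_cast hlt

/-- An adapted shear vanishes at least to the order given by the slope of the principal face. -/
theorem adaptedShear_order {φ : ℝ × ℝ → ℝ} {ψ : ℝ → ℝ} (hφ : SmoothNear φ 0) (hna : ¬ IsAdapted φ)
    (hψ : IsAdaptedShear φ ψ) {κ : ℝ × ℝ} (hκ : IsPrincipalWeight φ κ) (hκ1 : 0 < κ.1) :
    ∃ B, 0 ≤ B ∧ ∀ᶠ s in 𝓝 (0 : ℝ), |ψ s| ≤ B * |s| ^ (κ.2 / κ.1) := by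
  obtain ⟨hψs, hψ0, -⟩ := id hψ
  obtain ⟨⟨-, hκ2, hsup, -⟩, -, ⟨hdL, hdN⟩, -⟩ := hκ
  rcases SmoothNear.order_dichotomy hψs ⌈κ.2 / κ.1⌉₊ with ⟨B, hB, h⟩ | ⟨n, hn, c, hc, ⟨B, hB, h⟩, hlim⟩
  · refine ⟨B, hB, ?_⟩
    filter_upwards [h, Metric.ball_mem_nhds (0 : ℝ) one_pos] with s hs hs1
    rw [mem_ball_zero_iff, Real.norm_eq_abs] at hs1
    refine hs.trans (mul_le_mul_of_nonneg_left ?_ hB)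
    rw [← Real.rpow_natCast]
    exact Real.rpow_le_rpow_of_exponent_ge_of_imp (abs_nonneg _) hs1.le (Nat.le_ceil _)
      fun _ h1 => le_antisymm (h1 ▸ Nat.le_ceil _) (div_nonneg hκ2 hκ1.le)
  · exfalso
    -- For `n = 0` the limit `c` would be `ψ 0 = 0`.
    have hn1 : 1 ≤ n := by
      by_contra! h1
      obtain rfl : n = 0 := by omega
      have h2 : Tendsto ψ (𝓝[>] 0) (𝓝 0) := by
        have := (SmoothNear.contDiffAt hψs).continuousAt.tendsto
        rw [hψ0] at this
        exact this.mono_left nhdsWithin_le_nhds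
      exact hc (tendsto_nhds_unique (by simpa using hlim) h2)
    have hnκ : n * κ.1 < κ.2 := by
      rw [Nat.lt_ceil] at hn
      rwa [← lt_div_iff₀ hκ1]
    refine absurd (newtonDistance_shear_le hφ hψs hψ0 hn1 hc hB h hlim hκ1 hnκ hdN hdL
      fun α hα => hsup _ (mem_newtonPolyhedron hα)) (not_le.mpr ?_)
    exact newtonDistance_lt_of_isAdaptedShear hna hψ

/-- The supporting line of the principal face still meets the Newton polyhedron after a shear of
sufficiently high order. -/
theorem weightLine_inter_shear_nonempty {φ : ℝ × ℝ → ℝ} {ψ : ℝ → ℝ} (hφ : SmoothNear φ 0)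
    (hψ : SmoothNear ψ 0) (hψ0 : ψ 0 = 0) {κ : ℝ × ℝ} (hκ1 : 0 < κ.1) (hκ2 : 0 < κ.2)
    (hκ : IsSupportingWeight (newtonPolyhedron φ) κ) {B : ℝ} (hB : 0 ≤ B)
    (hψB : ∀ᶠ s in 𝓝 (0 : ℝ), |ψ s| ≤ B * |s| ^ (κ.2 / κ.1)) :
    (weightLine κ ∩ newtonPolyhedron (shear φ ψ)).Nonempty := by
  obtain ⟨-, -, hsup, t, htL, htN⟩ := hκ
  by_contra hempty
  have hge := le_weight_shear hφ hψ hψ0 hκ1 hκ2 hB hψB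
    fun α hα => hsup _ (mem_newtonPolyhedron hα)
  -- Weights of Taylor indices attain their minimum, so missing `L_κ` leaves a gap `r > 1`. Shearing
  -- back would carry this gap over to `φ`, whose polyhedron touches `L_κ`.
  obtain ⟨r, hr, hrle⟩ : ∃ r > 1, ∀ α ∈ taylorSupport (shear φ ψ), r ≤ κ.1 * α.1 + κ.2 * α.2 := by
    rcases (taylorSupport (shear φ ψ)).eq_empty_or_nonempty with h | h
    · exact ⟨2, one_lt_two, by simp [h]⟩
    · obtain ⟨α, hα, hmin⟩ := exists_minimal_weight h hκ1 hκ2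
      refine ⟨_, lt_of_le_of_ne (hge α hα) fun heq => hempty ?_, hmin⟩
      exact ⟨_, heq.symm, mem_newtonPolyhedron hα⟩
  have hback := le_weight_shear (hφ.shear hψ hψ0) (ψ := fun s => -ψ s)
    (hψ.mono fun s hs => hs.neg) (by simp [hψ0]) hκ1 hκ2 hB (by simpa using hψB) hrle
  rw [shear_shear_neg] at hback
  have h1 := le_weight_of_mem_newtonPolyhedron hκ1.le hκ2.le hback htN
  have h2 : κ.1 * t.1 + κ.2 * t.2 = 1 := htL
  linarith

/-- The half plane contains the ray `L⁺`, whose direction is `(-κ₂, κ₁)`, so `u t₁ + v t₂` cannot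
decrease along it. With `τ` below it would reach the value `0`. -/
theorem slope_le_of_supports_augmentedPolyhedron {g : ℝ × ℝ → ℝ} {κ : ℝ × ℝ} (hκ1 : 0 < κ.1)
    (hne : (weightLine κ ∩ newtonPolyhedron g).Nonempty) {u v : ℝ}
    (h : ∀ t ∈ augmentedPolyhedron g κ, 1 ≤ u * t.1 + v * t.2) : κ.2 / κ.1 * u ≤ v := by
  obtain ⟨s, hsL, hsN⟩ := hne
  have hsL' : κ.1 * s.1 + κ.2 * s.2 = 1 := hsL
  by_contra! hlt
  have hneg : 0 < u * κ.2 - v * κ.1 := by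
    rw [div_mul_eq_mul_div, lt_div_iff₀ hκ1] at hlt
    linarith
  have hs1 : 1 ≤ u * s.1 + v * s.2 := h s (subset_convexHull ℝ _ (Or.inl hsN))
  set τ := (u * s.1 + v * s.2) / (u * κ.2 - v * κ.1) with hτ
  have hτ0 : 0 ≤ τ := div_nonneg (by linarith) hneg.le
  have hτe : τ * (u * κ.2 - v * κ.1) = u * s.1 + v * s.2 := div_mul_cancel₀ _ hneg.ne'
  have hmem : ((s.1 - τ * κ.2, s.2 + τ * κ.1) : ℝ × ℝ) ∈ augmentingRay g κ := by
    refine ⟨?_, s, ⟨hsL, hsN⟩, ?_⟩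
    · show κ.1 * (s.1 - τ * κ.2) + κ.2 * (s.2 + τ * κ.1) = 1
      linarith
    · show s.2 ≤ s.2 + τ * κ.1
      nlinarith
  have := h _ (subset_convexHull ℝ _ (Or.inr hmem))
  simp only at this
  linarith

/-- Multiplying by `-1/2` turns the supremum into an infimum, so it suffices to treat each
supporting weight. Where `K(u) = +∞` there is no constraint; if this happens for all `u`, the right
side is `+∞`. -/
theorem le_neg_half_mul_legendre {a w c : ℝ} {N : Set (ℝ × ℝ)}
    (h : ∀ u ∈ Icc (0 : ℝ) a, ∀ v, IsSupportingWeight N (u, v) → c ≤ -(1 / 2) * (w * u - v)) :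
    (c : EReal) ≤ ((-(1 / 2) : ℝ) : EReal) * legendre a (supportFunction N) w := by
  have hle : legendre a (supportFunction N) w ≤ ((-2 * c : ℝ) : EReal) := by
    refine iSup₂_le fun u hu => ?_
    have hK : ((w * u + 2 * c : ℝ) : EReal) ≤ supportFunction N u := by
      refine le_iInf₂ fun v hv => ?_
      have := h u hu v hv
      exact EReal.coe_le_coe_iff.mpr (by linarith)
    generalize supportFunction N u = K at hK ⊢
    induction K using EReal.rec with
    | bot => exact absurd hK (not_le.mpr (EReal.bot_lt_coe _))
    | top => simp
    | coe k =>
      rw [EReal.coe_le_coe_iff] at hK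
      rw [← EReal.coe_sub, EReal.coe_le_coe_iff]
      linarith
  generalize legendre a (supportFunction N) w = L at hle ⊢
  induction L using EReal.rec with
  | bot =>
    rw [EReal.coe_mul_bot_of_neg (by norm_num)]
    exact le_top
  | top => exact absurd hle (not_le.mpr (EReal.coe_lt_top _))
  | coe l =>
    rw [EReal.coe_le_coe_iff] at hle
    rw [← EReal.coe_mul, EReal.coe_le_coe_iff]
    linarith

end MixedRestriction

/-! ### The necessary conditions -/

theorem theorem1
    (Ω : Set (ℝ × ℝ)) (hΩ : IsOpen Ω) (h0 : (0 : ℝ × ℝ) ∈ Ω)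
    (φ : ℝ × ℝ → ℝ) (hφ : ContDiffOn ℝ ∞ φ Ω) (hφ0 : φ 0 = 0) (hdφ : fderiv ℝ φ 0 = 0)
    (hfin : (taylorSupport φ).Nonempty)
    (ρ : ℝ × ℝ → ℝ) (hρ : ContDiff ℝ ∞ ρ) (hρc : HasCompactSupport ρ) (hρΩ : tsupport ρ ⊆ Ω)
    (hρnn : ∀ x, 0 ≤ ρ x) (hρ0 : ρ 0 ≠ 0)
    (p₁ p₃ p₁' p₃' : ℝ≥0∞)
    (hp₁ : ENNReal.HolderConjugate p₁ p₁') (hp₃ : ENNReal.HolderConjugate p₃ p₃')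
    (hest : RestrictionEstimate Ω φ ρ p₁ p₃) :
    (IsAdapted φ →
      1 / newtonDistance φ * (p₁'⁻¹).toReal + (p₃'⁻¹).toReal ≤ 1 / (2 * newtonDistance φ)) ∧
    (IsLinearlyAdapted φ → ¬ IsAdapted φ →
      ∀ κ : ℝ × ℝ, IsPrincipalWeight φ κ → κ.1 ≤ κ.2 →
      ∀ ψ : ℝ → ℝ, IsAdaptedShear φ ψ →
        (((p₃'⁻¹).toReal : ℝ) : EReal) ≤
          ((-(1 / 2) : ℝ) : EReal) *
            legendre κ.1 (supportFunction (augmentedPolyhedron (shear φ ψ) κ))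
              ((2 + 2 * (κ.2 / κ.1)) * (p₁'⁻¹).toReal - 1)) := by
  have hsm : SmoothNear φ 0 := by
    filter_upwards [hΩ.mem_nhds h0] with x hx
    exact hφ.contDiffAt (hΩ.mem_nhds hx)
  have hρpos : 0 < ρ 0 := lt_of_le_of_ne (hρnn 0) hρ0.symm
  have knapp {ψ : ℝ → ℝ} (hψ : SmoothNear ψ 0) (hψ0 : ψ 0 = 0) {u v μ B : ℝ} (hu : 0 < u)
      (hv : 0 < v) (hμ : 0 < μ) (hμv : μ ≤ v) (hB : 0 ≤ B)
      (hψB : ∀ᶠ s in 𝓝 (0 : ℝ), |ψ s| ≤ B * |s| ^ (μ / u))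
      (hs : ∀ α ∈ taylorSupport (shear φ ψ), 1 ≤ u * α.1 + v * α.2) :=
    knapp_condition hΩ h0 hsm hρ.continuous hρpos hp₁ hp₃ hest hψ hψ0 hu hv hμ hμv hB hψB hs
  constructor
  · intro _
    have hd := newtonDistance_pos hφ0 hdφ hfin
    obtain ⟨a, b, ha, hb, hab, hsup⟩ := exists_weight_at_diag hfin hd
    have hab' : a + b = 1 / newtonDistance φ := eq_div_of_mul_eq hd.ne' hab
    have hshear : shear φ (fun _ => 0) = φ := by
      funext y
      simp [shear]
    have key : (p₃'⁻¹).toReal + (a + b) * (p₁'⁻¹).toReal ≤ (a + b) / 2 := by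
      -- One of `a`, `b` may vanish if the supporting line is parallel to an axis, so both are
      -- raised by `δ`.
      refine le_of_forall_pos_le_add_mul (Z := 1 - 2 * (p₁'⁻¹).toReal) fun δ hδ => ?_
      have := knapp (ψ := fun _ => 0) (Eventually.of_forall fun s => contDiffAt_const) rfl
        (u := a + δ) (v := b + δ) (μ := b + δ) (B := 0) (by linarith) (by linarith) (by linarith)
        le_rfl le_rfl (by simp) (by
          rw [hshear]
          intro α hα
          have h1 := hsup _ (mem_newtonPolyhedron hα)
          have h2 : 0 ≤ δ * (α.1 + α.2) := by positivity
          simp only at h1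
          linarith)
      linarith
    have h2 : 1 / (2 * newtonDistance φ) = (a + b) / 2 := by rw [hab']; field_simp
    rw [h2, ← hab']
    linarith
  · intro _ hna κ hκ hκle ψ hψ
    obtain ⟨hψs, hψ0, -⟩ := id hψ
    refine le_neg_half_mul_legendre fun u hu v hv => ?_
    obtain ⟨-, hv0, hsup, t, htL, -⟩ := hv
    have hsupp (α : ℕ × ℕ) (hα : α ∈ taylorSupport (shear φ ψ)) : 1 ≤ u * α.1 + v * α.2 :=
      hsup _ (subset_convexHull ℝ _ (Or.inl (mem_newtonPolyhedron hα)))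
    -- For `u = 0` the slope term drops out and only `1/p₃' ≤ v/2` is needed. It follows from the
    -- weights `(δ, v)` with small `δ` and `μ = δ`, for which `ψ = O(|s|)` suffices.
    rcases hu.1.eq_or_lt with rfl | hu0
    · have htL' : 0 * t.1 + v * t.2 = 1 := htL
      have hvpos : 0 < v := lt_of_le_of_ne hv0 fun h => by simp [← h] at htL'
      obtain ⟨B, hB, hψB⟩ : ∃ B, 0 ≤ B ∧ ∀ᶠ s in 𝓝 (0 : ℝ), |ψ s| ≤ B * |s| ^ (1 : ℝ) := by
        have hO := (SmoothNear.contDiffAt hψs).differentiableAt (by simp) |>.isBigO_sub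
        obtain ⟨B, hB, h⟩ := hO.exists_nonneg
        refine ⟨B, hB, h.bound.mono fun s hs => ?_⟩
        simpa [hψ0] using hs
      have key : (p₃'⁻¹).toReal ≤ v / 2 := by
        have hpos : (0 : ℝ) ≤ (p₁'⁻¹).toReal := ENNReal.toReal_nonneg
        by_contra! hcon
        -- The first entry gives `μ ≤ v`; the second makes `1/p₃' ≥ v/2 + δ`, against the bound `(δ
        -- + v)/2` from the test.
        set δ := min v ((p₃'⁻¹).toReal - v / 2) with hδ
        have hδ0 : 0 < δ := lt_min hvpos (by linarith)
        have := knapp hψs hψ0 (u := δ) (v := v) (μ := δ) hδ0 hvpos hδ0 (min_le_left _ _) hB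
          (by rwa [div_self hδ0.ne']) fun α hα => by
            have h1 := hsupp α hα
            have h2 : 0 ≤ δ * α.1 := by positivity
            linarith
        have h3 : δ ≤ (p₃'⁻¹).toReal - v / 2 := min_le_right _ _
        have h4 : 0 ≤ (δ + δ) * (p₁'⁻¹).toReal := by positivity
        linarith
      linarith
    · have hκ1 : 0 < κ.1 := hu0.trans_le hu.2
      have hκ2 : 0 < κ.2 := hκ1.trans_le hκle
      obtain ⟨B, hB, hψB⟩ := adaptedShear_order hsm hna hψ hκ hκ1
      have hslope := slope_le_of_supports_augmentedPolyhedron hκ1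
        (weightLine_inter_shear_nonempty hsm hψs hψ0 hκ1 hκ2 hκ.1 hB hψB) hsup
      have hμ : 0 < κ.2 / κ.1 * u := by positivity
      have := knapp hψs hψ0 hu0 (hμ.trans_le hslope) hμ hslope hB
        (by rwa [mul_div_cancel_right₀ _ hu0.ne']) hsupp
      linarith
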